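/- Let $n\ge 0$ and let $Z=(z_0,\dots,z_n)$ be the homogeneous coordinates of $\mathbb{CP}^n$. Let $\Lambda=(\Lambda^{\alpha\beta})_{0\le\alpha,\beta\le n}$ be a matrix of homogeneous polynomials of degree $2$ in $\mathbb C[Z]$ such that $\{f,g\}=\sum_{\alpha,\beta}\Lambda^{\alpha\beta}\,\partial_{\alpha}f\,\partial_{\beta}g$ is skew-symmetric and satisfies the Jacobi identity on $\mathbb C[Z]$ (a holomorphic Poisson biderivation of order zero), and such that for all $k\ge 0$ and all polynomials $f,g$ $$f\,(\overleftarrow{\partial_{\alpha_1}}\Lambda^{\alpha_1\beta_1}\overrightarrow{\partial_{\beta_1}})\cdots(\overleftarrow{\partial_{\alpha_k}}\Lambda^{\alpha_k\beta_k}\overrightarrow{\partial_{\beta_k}})\,g=\Lambda^{\alpha_1\beta_1}\cdots\Lambda^{\alpha_k\beta_k}\,(\partial_{\alpha_1}\cdots\partial_{\alpha_k}f)(\partial_{\beta_1}\cdots\partial_{\beta_k}g)$$ (repeated indices are summed), where on the left each arrow differentiates everything on the side it points to, including the coefficients $\Lambda^{\alpha\beta}$. Let $\mu$ be a formal parameter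 and let $\mathbb C[\mu,\mu^{-1}]]$ be the field of formal Laurent series in $\mu^{-1}$. On $\mathbb C[\mu,\mu^{-1}]][[Z]]$, the space of formal sums over $k\ge0$ of homogeneous polynomials of degree $k$ in $Z$ with coefficients in $\mathbb C[\mu,\mu^{-1}]]$, put $$f\star g=\sum_{k\ge 0}\frac1{k!}\Big(\frac\mu2\Big)^k\Lambda^{\alpha_1\beta_1}\cdots\Lambda^{\alpha_k\beta_k}\,(\partial_{\alpha_1}\cdots\partial_{\alpha_k}f)(\partial_{\beta_1}\cdots\partial_{\beta_k}g).$$ Let $A$ be a complex symmetric $(n+1)\times(n+1)$ matrix, $A[Z]=ZA\,{}^tZ$, and $$e_\star^{\frac1\mu A[Z]}=\sum_{k\ge0}\frac1{k!}\Big(\frac1\mu A[Z]\Big)^{\star k}.$$ Then: 1. This series converges formally (only finitely many terms contribute to each coefficient), and $F(t)=e_\star^{\frac t\mu A[Z]}$, $t\in\mathbb C$, is the unique solution of $\partial_tF=\frac1\mu A[Z]\star F$, $F(0)=1$, where the derivative in $t$ is taken coefficientwise. 2. One has $$e_\star^{\frac1\mu A[Z]}=\det{}^{-1/2}\Big(\frac{e^{\Lambda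 A}+e^{-\Lambda A}}2\Big)\cdot\exp\Big(\frac1\mu\Big(\frac{\Lambda^{-1}}{\sqrt{-1}}\tan(\sqrt{-1}\,\Lambda A)\Big)[Z]\Big).$$ Here functions of $\Lambda A$ are given by their Taylor series at $0$; $\det^{-1/2}$ is the square root of the inverse determinant with constant term $1$; and if $\frac1{\sqrt{-1}}\tan(\sqrt{-1}\,x)=\sum_{k\ge0}p_{k+1}x^{k+1}$, then $\frac{\Lambda^{-1}}{\sqrt{-1}}\tan(\sqrt{-1}\,\Lambda A)$ denotes $\sum_{k\ge0}p_{k+1}A(\Lambda A)^k$, so that $\Lambda$ need not be invertible. 3. $e_\star^{\frac1\mu A[Z]}\in\sum_{k=0}^\infty H^0(\mathbb{CP}^n,\mathcal O(k)[\mu,\mu^{-1}]])$ as a formal infinite sum: for each $k$, the component of degree $k$ in $Z$ is a Laurent series in $\mu^{-1}$ whose coefficients are global holomorphic sections of $\mathcal O(k)$. -/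

import Mathlib

open scoped LinearAlgebra.Projectivization

noncomputable section

namespace StarExp

/-- Polynomials in the homogeneous coordinates `Z = (z₀, …, zₙ)` of `ℂPⁿ`. -/
abbrev Poly (n : ℕ) : Type := MvPolynomial (Fin (n + 1)) ℂ

/-! ### The Poisson biderivation in homogeneous coordinates -/

/-- The biderivation `f ←∂_α Λ^{αβ} →∂_β g = ∑ Λ^{αβ} (∂_α f) (∂_β g)`. -/
def bracket {n : ℕ} (Λ : Matrix (Fin (n + 1)) (Fin (n + 1)) (Poly n)) (f g : Poly n) : Poly n :=
  ∑ α, ∑ β, Λ α β * MvPolynomial.pderiv α f * MvPolynomial.pderiv β g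

/-- The iterated derivative `∂_{α₁} ⋯ ∂_{αₖ} f` of a polynomial. -/
def iterDeriv {n k : ℕ} (α : Fin k → Fin (n + 1)) (f : Poly n) : Poly n :=
  (List.ofFn α).foldr (fun i p => MvPolynomial.pderiv i p) f

/-- `p` written in the `c`-th copy of the coordinates. -/
def inCopy {n : ℕ} (c : ℕ) (p : Poly n) : MvPolynomial (ℕ × Fin (n + 1)) ℂ :=
  MvPolynomial.rename (fun i => (c, i)) p

/-- The arrow `←∂_α` standing at position `p` of a product of functions, numbered from left to
right, the `c`-th of which is written in the `c`-th copy of the coordinates: it differentiates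
every function to its left. -/
def leftArrow {n : ℕ} (p : ℕ) (α : Fin (n + 1)) :
    Module.End ℂ (MvPolynomial (ℕ × Fin (n + 1)) ℂ) :=
  ∑ c ∈ Finset.range p, (MvPolynomial.pderiv (R := ℂ) (c, α)).toLinearMap

/-- The arrow `→∂_β` standing at position `p` of a product of functions numbered
`0, …, last`: it differentiates every function to its right. -/
def rightArrow {n : ℕ} (last p : ℕ) (β : Fin (n + 1)) :
    Module.End ℂ (MvPolynomial (ℕ × Fin (n + 1)) ℂ) :=
  ∑ c ∈ Finset.Ioc p last, (MvPolynomial.pderiv (R := ℂ) (c, β)).toLinearMap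

/-- The product of `k` biderivations
`f (←∂_{α₁} Λ^{α₁β₁} →∂_{β₁}) ⋯ (←∂_{αₖ} Λ^{αₖβₖ} →∂_{βₖ}) g`, summed over all indices.
Each left arrow acts on everything to its left and each right arrow on everything to its right,
the coefficients `Λ^{αβ}` included. To say so, the factors `f, Λ, …, Λ, g` are
written in separate copies `0, 1, …, k, k + 1` of the coordinates, the (commuting) arrows are
applied, and then the copies are identified. -/
def arrowProduct {n : ℕ} (Λ : Matrix (Fin (n + 1)) (Fin (n + 1)) (Poly n)) (k : ℕ)
    (f g : Poly n) : Poly n :=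
  ∑ α : Fin k → Fin (n + 1), ∑ β : Fin k → Fin (n + 1),
    MvPolynomial.rename Prod.snd
      ((List.ofFn fun i : Fin k =>
          leftArrow (i + 1) (α i) * rightArrow (k + 1) (i + 1) (β i)).prod
        (inCopy 0 f * (∏ i : Fin k, inCopy (i + 1) (Λ (α i) (β i))) * inCopy (k + 1) g))

/-- The standing assumptions on `Λ = ∑ ←∂_α Λ^{αβ} →∂_β`. -/
structure IsQuantizable {n : ℕ} (Λ : Matrix (Fin (n + 1)) (Fin (n + 1)) (Poly n)) : Prop where
  /-- Order zero: the bracket of homogeneous functions of degrees `k` and `l` has degree `k + l`,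
  so that `Λ` acts on the structure sheaf of `ℂPⁿ`; equivalently the coefficients
  `Λ^{αβ} = {z_α, z_β}` are quadratic. -/
  orderZero : ∀ α β, (Λ α β).IsHomogeneous 2
  skew : ∀ f g, bracket Λ f g = -bracket Λ g f
  jacobi : ∀ f g h, bracket Λ f (bracket Λ g h) + bracket Λ g (bracket Λ h f)
    + bracket Λ h (bracket Λ f g) = 0
  /-- The product of `k` biderivations does not see the derivatives of the coefficients. -/
  arrow_relation : ∀ (k : ℕ) (f g : Poly n),
    arrowProduct Λ k f g =
      ∑ α : Fin k → Fin (n + 1), ∑ β : Fin k → Fin (n + 1),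
        (∏ i, Λ (α i) (β i)) * iterDeriv α f * iterDeriv β g

/-! ### Formal series and the star product -/

/-- The scalars `ℂ[μ, μ⁻¹]]`: Laurent series in the variable `μ⁻¹`. The coefficient of index `j`
of such a series is its coefficient at `μ⁻ʲ`. -/
abbrev Scalars : Type := LaurentSeries ℂ

/-- The formal parameter `μ`. -/
def mu : Scalars := HahnSeries.single (-1 : ℤ) (1 : ℂ)

/-- Formal sums over `k` of homogeneous polynomials of degree `k` in `Z` with
coefficients in `ℂ[μ, μ⁻¹]]`, that is, formal power series in `Z`. -/
abbrev Series (n : ℕ) : Type := MvPowerSeries (Fin (n + 1)) Scalars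

/-- A polynomial as a series. -/
def toSeries {n : ℕ} (p : Poly n) : Series n :=
  ((MvPolynomial.map (HahnSeries.C : ℂ →+* Scalars) p : MvPolynomial (Fin (n + 1)) Scalars) : Series n)

/-- A family of series is summable if each coefficient is nonzero for finitely many members. -/
def IsFormallySummable {n : ℕ} (u : ℕ → Series n) : Prop :=
  ∀ m, {k | MvPowerSeries.coeff m (u k) ≠ 0}.Finite

/-- The coefficientwise sum of a summable family. -/
def formalSum {n : ℕ} (u : ℕ → Series n) : Series n :=
  fun m => ∑ᶠ k, MvPowerSeries.coeff m (u k)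

/-- The iterated derivative `∂_{α₁} ⋯ ∂_{αₖ} f` of a series. -/
def iterDerivSeries {n k : ℕ} (α : Fin k → Fin (n + 1)) (f : Series n) : Series n :=
  (List.ofFn α).foldr (fun i p => MvPowerSeries.pderiv Scalars i p) f

/-- The `k`-th term of the star product. -/
def starTerm {n : ℕ} (Λ : Matrix (Fin (n + 1)) (Fin (n + 1)) (Poly n)) (f g : Series n)
    (k : ℕ) : Series n :=
  ((k.factorial : Scalars)⁻¹ * (mu / 2) ^ k) •
    ∑ α : Fin k → Fin (n + 1), ∑ β : Fin k → Fin (n + 1),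
      (∏ i, toSeries (Λ (α i) (β i))) * iterDerivSeries α f * iterDerivSeries β g

lemma le_order_toSeries {n d : ℕ} (p : Poly n) (hp : p.IsHomogeneous d) : (d : ℕ∞) ≤ (toSeries p).order := by
  apply MvPowerSeries.le_order
  intro m hm
  have hm' : m.degree < d := by exact_mod_cast hm
  simp only [toSeries, MvPolynomial.coeff_coe, MvPolynomial.coeff_map]
  rw [hp.coeff_eq_zero (by omega), map_zero]

lemma summable_starTerm {n : ℕ} (Λ : Matrix (Fin (n + 1)) (Fin (n + 1)) (Poly n))
    (h : ∀ α β, (Λ α β).IsHomogeneous 2) (f g : Series n) : IsFormallySummable (starTerm Λ f g) := by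
  intro m
  refine (Set.finite_le_nat m.degree).subset fun k hk => ?_
  by_contra hlt
  simp only [Set.mem_ofPred_eq, not_le] at hlt
  apply hk
  rw [starTerm, MvPowerSeries.coeff_smul, map_sum]
  simp only [map_sum]
  rw [Finset.sum_eq_zero, mul_zero]
  intro a _
  apply Finset.sum_eq_zero
  intro b _
  apply MvPowerSeries.coeff_of_lt_order
  have hprod : (∏ i, toSeries (Λ (a i) (b i))) = toSeries (∏ i, Λ (a i) (b i)) := by
    have := (map_prod ((MvPolynomial.coeToMvPowerSeries.ringHom (R := Scalars) (σ := Fin (n+1))).comp (MvPolynomial.map (HahnSeries.C : ℂ →+* Scalars))) (fun i => Λ (a i) (b i)) Finset.univ).symm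
    exact this
  have h2 := le_order_toSeries _ (MvPolynomial.IsHomogeneous.prod Finset.univ (fun i => Λ (a i) (b i)) (fun _ => 2) (fun i _ => h _ _))
  rw [← hprod] at h2
  refine lt_of_lt_of_le ?_ (MvPowerSeries.le_order_mul)
  refine lt_of_lt_of_le ?_ (add_le_add_left MvPowerSeries.le_order_mul _)
  rw [add_assoc]
  refine lt_of_lt_of_le ?_ (le_add_right h2)
  simp
  norm_cast; omega

/-- The star product
`f ⋆ g = ∑ₖ (1/k!) (μ/2)ᵏ Λ^{α₁β₁} ⋯ Λ^{αₖβₖ} (∂_{α₁} ⋯ ∂_{αₖ} f) (∂_{β₁} ⋯ ∂_{βₖ} g)`.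
For `Λ` with quadratic coefficients the sum is summable, see `summable_starTerm`. -/
def star {n : ℕ} (Λ : Matrix (Fin (n + 1)) (Fin (n + 1)) (Poly n)) (f g : Series n) : Series n :=
  formalSum (starTerm Λ f g)

/-- The powers `f ⋆ ⋯ ⋆ f`. -/
def starPow {n : ℕ} (Λ : Matrix (Fin (n + 1)) (Fin (n + 1)) (Poly n)) (f : Series n) :
    ℕ → Series n
  | 0 => 1
  | k + 1 => star Λ f (starPow Λ f k)

/-- The `k`-th term `(1/k!) f^{⋆k}` of the star exponential series. -/
def starExpTerm {n : ℕ} (Λ : Matrix (Fin (n + 1)) (Fin (n + 1)) (Poly n)) (f : Series n)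
    (k : ℕ) : Series n :=
  (k.factorial : Scalars)⁻¹ • starPow Λ f k

/-- The star exponential `e_⋆^f = ∑ₖ (1/k!) f^{⋆k}`. -/
def starExp {n : ℕ} (Λ : Matrix (Fin (n + 1)) (Fin (n + 1)) (Poly n)) (f : Series n) : Series n :=
  formalSum (starExpTerm Λ f)

/-- The quadratic form `Q[Z] = Z Q ᵗZ`. -/
def quadForm {n : ℕ} (Q : Matrix (Fin (n + 1)) (Fin (n + 1)) (Series n)) : Series n :=
  ∑ i, ∑ j, MvPowerSeries.X i * Q i j * MvPowerSeries.X j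

/-- A constant matrix as a matrix of series. -/
def constMat {n : ℕ} (A : Matrix (Fin (n + 1)) (Fin (n + 1)) ℂ) :
    Matrix (Fin (n + 1)) (Fin (n + 1)) (Series n) :=
  A.map fun a => toSeries (MvPolynomial.C a)

/-- The element `(1/μ) A[Z]`. -/
def hamiltonian {n : ℕ} (A : Matrix (Fin (n + 1)) (Fin (n + 1)) ℂ) : Series n :=
  mu⁻¹ • quadForm (constMat A)

/-! ### The closed form -/

/-- The matrix `Λ A`. -/
def lambdaA {n : ℕ} (Λ : Matrix (Fin (n + 1)) (Fin (n + 1)) (Poly n))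
    (A : Matrix (Fin (n + 1)) (Fin (n + 1)) ℂ) :
    Matrix (Fin (n + 1)) (Fin (n + 1)) (Series n) :=
  Λ.map toSeries * constMat A

/-- The value `p(M) = ∑ₖ pₖ Mᵏ` of a power series in one variable at a square matrix `M`.
It is used for matrices whose entries have no constant term. -/
def matEval {n : ℕ} (p : PowerSeries ℂ) (M : Matrix (Fin (n + 1)) (Fin (n + 1)) (Series n)) :
    Matrix (Fin (n + 1)) (Fin (n + 1)) (Series n) :=
  fun i j => formalSum fun k => (HahnSeries.C (PowerSeries.coeff k p) : Scalars) • (M ^ k) i j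

/-- The matrix `(e^{ΛA} + e^{-ΛA}) / 2`. -/
def coshMat {n : ℕ} (Λ : Matrix (Fin (n + 1)) (Fin (n + 1)) (Poly n))
    (A : Matrix (Fin (n + 1)) (Fin (n + 1)) ℂ) :
    Matrix (Fin (n + 1)) (Fin (n + 1)) (Series n) :=
  (2 : Scalars)⁻¹ •
    (matEval (PowerSeries.exp ℂ) (lambdaA Λ A) + matEval (PowerSeries.exp ℂ) (-lambdaA Λ A))

/-- The Taylor series at `0` of `(1/√-1) tan (√-1 x)`. -/
def tanSeries : PowerSeries ℂ :=
  Complex.I⁻¹ •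
    PowerSeries.rescale Complex.I (PowerSeries.sin ℂ * (PowerSeries.cos ℂ)⁻¹)

/-- The matrix `(Λ⁻¹/√-1) tan (√-1 Λ A)`. The Taylor series `p` of `(1/√-1) tan (√-1 x)` has
no constant term, `p = ∑ₖ pₖ₊₁ xᵏ⁺¹`, and `Λ⁻¹ p(ΛA)` is by definition
`∑ₖ pₖ₊₁ A (ΛA)ᵏ`: the first factor `Λ` of each `(ΛA)ᵏ⁺¹` is cancelled. This
makes sense when `Λ` is not invertible, too. -/
def phaseMat {n : ℕ} (Λ : Matrix (Fin (n + 1)) (Fin (n + 1)) (Poly n))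
    (A : Matrix (Fin (n + 1)) (Fin (n + 1)) ℂ) :
    Matrix (Fin (n + 1)) (Fin (n + 1)) (Series n) :=
  constMat A *
    matEval (PowerSeries.mk fun k => PowerSeries.coeff (k + 1) tanSeries) (lambdaA Λ A)

/-- The exponential `e^x = ∑ₖ xᵏ/k!` of a series without constant term. -/
def expSeries {n : ℕ} (x : Series n) : Series n :=
  (PowerSeries.map (HahnSeries.C : ℂ →+* Scalars) (PowerSeries.exp ℂ)).subst x

/-! ### Sections of `𝒪(k)` on projective space -/

/-- The cone in `ℂⁿ⁺¹ ∖ {0}` over a subset of `ℂPⁿ`. -/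
def cone {n : ℕ} (U : Set (ℙ ℂ (Fin (n + 1) → ℂ))) : Set (Fin (n + 1) → ℂ) :=
  {z | ∃ hz : z ≠ 0, Projectivization.mk ℂ z hz ∈ U}

/-- The sections of `𝒪(k)` over an open subset `U` of `ℂPⁿ`: holomorphic functions on the cone
over `U` that are homogeneous of degree `k`. -/
def twistedSections (n : ℕ) (k : ℤ) (U : Set (ℙ ℂ (Fin (n + 1) → ℂ))) :
    Submodule ℂ (cone U → ℂ) where
  carrier := {s | (∃ F : (Fin (n + 1) → ℂ) → ℂ, DifferentiableOn ℂ F (cone U) ∧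
      ∀ z : cone U, s z = F z) ∧
    ∀ (c : ℂ) (z w : cone U), c ≠ 0 → (w : Fin (n + 1) → ℂ) = c • (z : Fin (n + 1) → ℂ) →
      s w = c ^ k * s z}
  add_mem' := by
    rintro s t ⟨⟨F, hF, hs⟩, hs'⟩ ⟨⟨G, hG, ht⟩, ht'⟩
    refine ⟨⟨F + G, hF.add hG, fun z => by simp [hs, ht]⟩, fun c z w hc hw => ?_⟩
    simp only [Pi.add_apply, hs' c z w hc hw, ht' c z w hc hw]
    ring
  zero_mem' := ⟨⟨0, differentiableOn_const 0, fun z => by simp⟩, fun c z w hc hw => by simp⟩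
  smul_mem' := by
    rintro a s ⟨⟨F, hF, hs⟩, hs'⟩
    refine ⟨⟨a • F, hF.const_smul a, fun z => by simp [hs]⟩, fun c z w hc hw => ?_⟩
    simp only [Pi.smul_apply, smul_eq_mul, hs' c z w hc hw]
    ring

/-- The space of global sections `H⁰(ℂPⁿ, 𝒪(k))`. -/
abbrev H0 (n : ℕ) (k : ℤ) : Type := twistedSections n k Set.univ

/-- The component of degree `k` in `Z` of the coefficient of `μ⁻ʲ` of a series. -/
def component {n : ℕ} (F : Series n) (k : ℕ) (j : ℤ) : Poly n :=
  ∑ m ∈ (Finset.univ : Finset (Fin (n + 1))).finsuppAntidiag k,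
    MvPolynomial.monomial m ((MvPowerSeries.coeff m F).coeff j)

/-- `F` is an element of `∑ₖ H⁰(ℂPⁿ, 𝒪(k)[μ, μ⁻¹]])`, a formal sum over all `k ≥ 0`: for every `k`
the component of `F` of degree `k` in `Z` is given by a Laurent series in `μ⁻¹` whose
coefficients are global sections of `𝒪(k)`. -/
def IsSumOfSections {n : ℕ} (F : Series n) : Prop :=
  ∃ s : (k : ℕ) → LaurentSeries (H0 n k),
    ∀ (k : ℕ) (j : ℤ) (z : cone (Set.univ : Set (ℙ ℂ (Fin (n + 1) → ℂ)))),
      ((s k).coeff j : cone Set.univ → ℂ) z = MvPolynomial.eval (z : Fin (n + 1) → ℂ) (component F k j)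

end StarExp

end

/-!
The arrow relation for two factors, skew-symmetry and the Jacobi identity together force
`{z_a, Λ^{bc}} = 0` (`IsQuantizable.bracket_X_coeff`): the coefficients of `Λ` are Casimir
functions. Hence the star product by a quadratic form
collapses to a second order operator in the derivations `D_α = {z_α, ·} = ∑ Λ^{αβ} ∂_β`,
`(1/μ) A[Z] ⋆ f = (1/μ) A[Z] f + ∑ (A Z)_α D_α f + (μ/4) ∑ A_{αβ} D_α D_β f`
(`hamOp`, `IsQuantizable.star_hamiltonian`), and the `D_α` treat `Λ` as a constant.

This operator `L` raises the degree in `Z` by exactly two. So the `k`-th term of the star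
exponential is homogeneous of degree `2k`, which gives the convergence, and both equations that
characterize the star exponential have unique solutions, by induction on the degree: the evolution
equation in `t` (`IsQuantizable.eq_of_hasDerivAt`) and the equation `E F = 2 L F`,
`F = 1 + ⋯`, where `E = ∑ zᵢ ∂ᵢ` is the Euler field (`IsQuantizable.eq_zero_of_euler_eq`).
The Euler equation expresses the evolution equation at `t = 1` by means of the grading, and so
the closed form can be checked without a time variable.

For the closed form `G = g exp ((1/μ) Q[Z])`, put `M = ΛA` and `T = tanh M`. Since `E M = 2 M` and
`D_α M = 0`, the derivations act on functions of `M` by the chain rule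
(`map_derivation_matEval`). The equation `E G = 2 L G` (`IsQuantizable.euler_closedForm`) splits
into the Riccati equation `2 Q + E Q = 2 (A - A T²)`, which is `tanh' = 1 - tanh²`, and
`E g = - tr (M T) g`, which follows from Jacobi's formula for `det cosh M`.

Infinite sums are handled as sums in the product topology on the coefficients, in which
a coefficientwise finite sum converges to its formal value.
-/

noncomputable section

namespace StarExp

open scoped MvPowerSeries.WithPiTopology Matrix

open MvPowerSeries (coeff)

variable {n : ℕ}

-- Shortcuts: instance search through `LaurentSeries` is too long for composite problems.
scoped instance : CommRing (Series n) := MvPowerSeries.instCommRing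

scoped instance : CommSemiring (Series n) := MvPowerSeries.instCommSemiring

scoped instance : Semiring (Series n) := MvPowerSeries.instSemiring

/-! ### Formal sums as topological sums -/

lemma hasSum_of_finite_coeff {ι : Type*} (u : ι → Series n)
    (hu : ∀ m, {k | coeff m (u k) ≠ 0}.Finite) :
    HasSum u (fun m => ∑ᶠ k, coeff m (u k) : Series n) := by
  refine MvPowerSeries.WithPiTopology.hasSum_iff_hasSum_coeff.2 fun m => ?_
  have h1 : coeff m (fun m => ∑ᶠ k, coeff m (u k) : Series n) = ∑ᶠ k, coeff m (u k) := rfl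
  rw [h1, finsum_eq_sum_of_support_subset (s := (hu m).toFinset) _ (by
    intro k hk; simpa using hk)]
  exact hasSum_sum_of_ne_finset_zero fun k hk => by simpa using hk

lemma IsFormallySummable.hasSum {u : ℕ → Series n} (hu : IsFormallySummable u) :
    HasSum u (formalSum u) :=
  hasSum_of_finite_coeff u hu

lemma isFormallySummable_of_le_order {u : ℕ → Series n}
    (hu : ∀ k : ℕ, (k : ℕ∞) ≤ (u k).order) : IsFormallySummable u := by
  intro m
  refine (Set.finite_le_nat m.degree).subset fun k hk => ?_
  by_contra hlt
  simp only [Set.mem_ofPred_eq, not_le] at hlt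
  exact hk (MvPowerSeries.coeff_of_lt_order (lt_of_lt_of_le (Nat.cast_lt.2 hlt) (hu k)))

/-- The embedding of the complex numbers into the formal series. -/
def scalar (n : ℕ) : ℂ →+* Series n :=
  (MvPowerSeries.C (σ := Fin (n + 1)) (R := Scalars)).comp (HahnSeries.C : ℂ →+* Scalars)

lemma C_smul (a : ℂ) (f : Series n) : (HahnSeries.C a : Scalars) • f = scalar n a * f :=
  MvPowerSeries.smul_eq_C_mul f (HahnSeries.C a : Scalars)

lemma derivation_scalar_mul (δ : Derivation Scalars (Series n) (Series n)) (a : ℂ)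
    (f : Series n) : δ (scalar n a * f) = scalar n a * δ f := by
  have h : δ (scalar n a) = 0 := δ.map_algebraMap (HahnSeries.C a)
  rw [Derivation.leibniz, h, smul_zero, add_zero, smul_eq_mul]

lemma le_order_scalar_mul (a : ℂ) (f : Series n) : f.order ≤ (scalar n a * f).order := by
  rw [← C_smul]
  exact MvPowerSeries.le_order_smul

/-! ### Functions of a matrix of series -/

/-- The entries of `M ^ k` have order at least `k` when those of `M` have no constant term. -/
lemma le_order_matrix_pow {M : Matrix (Fin (n + 1)) (Fin (n + 1)) (Series n)}
    (hM : ∀ i j, 1 ≤ (M i j).order) (k : ℕ) (i j : Fin (n + 1)) :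
    (k : ℕ∞) ≤ ((M ^ k) i j).order := by
  induction k generalizing i j with
  | zero => simp
  | succ k ih =>
    rw [pow_succ, Matrix.mul_apply]
    refine MvPowerSeries.le_order fun d hd => ?_
    rw [map_sum]
    refine Finset.sum_eq_zero fun l _ => MvPowerSeries.coeff_of_lt_order ?_
    refine lt_of_lt_of_le hd (le_trans ?_ MvPowerSeries.le_order_mul)
    push_cast
    exact add_le_add (ih i l) (hM l j)

/-- The `k`-th term `pₖ Mᵏ` of `p(M)`. -/
def matTerm (p : PowerSeries ℂ) (M : Matrix (Fin (n + 1)) (Fin (n + 1)) (Series n)) (k : ℕ) :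
    Matrix (Fin (n + 1)) (Fin (n + 1)) (Series n) :=
  scalar n (PowerSeries.coeff k p) • M ^ k

lemma hasSum_matEval (p : PowerSeries ℂ) {M : Matrix (Fin (n + 1)) (Fin (n + 1)) (Series n)}
    (hM : ∀ i j, 1 ≤ (M i j).order) : HasSum (matTerm p M) (matEval p M) := by
  refine Pi.hasSum.2 fun i => Pi.hasSum.2 fun j => ?_
  have h : (fun k => matTerm p M k i j) = fun k =>
      (HahnSeries.C (PowerSeries.coeff k p) : Scalars) • (M ^ k) i j := by
    funext k
    rw [C_smul]
    rfl
  rw [h]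
  exact IsFormallySummable.hasSum (isFormallySummable_of_le_order fun k =>
    (le_order_matrix_pow hM k i j).trans MvPowerSeries.le_order_smul)

lemma matTerm_mul_matTerm (p q : PowerSeries ℂ)
    (M : Matrix (Fin (n + 1)) (Fin (n + 1)) (Series n)) (k l : ℕ) :
    matTerm p M k * matTerm q M l =
      scalar n (PowerSeries.coeff k p * PowerSeries.coeff l q) • M ^ (k + l) := by
  rw [matTerm, matTerm, smul_mul_smul_comm, pow_add, map_mul]

lemma matEval_mul (p q : PowerSeries ℂ) {M : Matrix (Fin (n + 1)) (Fin (n + 1)) (Series n)}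
    (hM : ∀ i j, 1 ≤ (M i j).order) : matEval (p * q) M = matEval p M * matEval q M := by
  have hs : Summable fun x : ℕ × ℕ => matTerm p M x.1 * matTerm q M x.2 := by
    refine Pi.summable.2 fun i => Pi.summable.2 fun j => ?_
    refine ⟨_, hasSum_of_finite_coeff _ fun m => ?_⟩
    refine ((Set.finite_le_nat m.degree).prod (Set.finite_le_nat m.degree)).subset fun x hx => ?_
    have hle : x.1 + x.2 ≤ m.degree := by
      by_contra hlt
      rw [not_le] at hlt
      apply hx
      rw [matTerm_mul_matTerm]
      refine MvPowerSeries.coeff_of_lt_order (lt_of_lt_of_le (Nat.cast_lt.2 hlt) ?_)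
      exact (le_order_matrix_pow hM _ i j).trans (le_order_scalar_mul _ _)
    constructor
    · exact (Nat.le_add_right _ _).trans hle
    · exact (Nat.le_add_left _ _).trans hle
  have hp := hasSum_matEval p hM
  have hq := hasSum_matEval q hM
  rw [← hp.tsum_eq, ← hq.tsum_eq,
    hp.summable.tsum_mul_tsum_eq_tsum_sum_antidiagonal hq.summable hs,
    ← (hasSum_matEval (p * q) hM).tsum_eq]
  refine tsum_congr fun k => ?_
  rw [matTerm, PowerSeries.coeff_mul, map_sum, Finset.sum_smul]
  refine Finset.sum_congr rfl fun x hx => ?_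
  rw [matTerm_mul_matTerm, Finset.HasAntidiagonal.mem_antidiagonal.1 hx]

lemma matEval_add (p q : PowerSeries ℂ) {M : Matrix (Fin (n + 1)) (Fin (n + 1)) (Series n)}
    (hM : ∀ i j, 1 ≤ (M i j).order) : matEval (p + q) M = matEval p M + matEval q M := by
  refine (hasSum_matEval (p + q) hM).unique ?_
  convert (hasSum_matEval p hM).add (hasSum_matEval q hM) using 2 with k
  rw [matTerm, matTerm, matTerm, map_add, map_add, add_smul]

lemma matEval_smul (c : ℂ) (p : PowerSeries ℂ)
    {M : Matrix (Fin (n + 1)) (Fin (n + 1)) (Series n)}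
    (hM : ∀ i j, 1 ≤ (M i j).order) :
    matEval (c • p) M = scalar n c • matEval p M := by
  refine (hasSum_matEval (c • p) hM).unique ?_
  refine Pi.hasSum.2 fun i => Pi.hasSum.2 fun j => ?_
  refine Eq.mpr (congrArg (HasSum · _) (funext fun k => ?_))
    ((Pi.hasSum.1 (Pi.hasSum.1 (hasSum_matEval p hM) i) j).mul_left (scalar n c))
  change scalar n (PowerSeries.coeff k (c • p)) * (M ^ k) i j =
    scalar n c * (scalar n (PowerSeries.coeff k p) * (M ^ k) i j)
  rw [PowerSeries.coeff_smul, smul_eq_mul, map_mul, mul_assoc]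

lemma matEval_one {M : Matrix (Fin (n + 1)) (Fin (n + 1)) (Series n)}
    (hM : ∀ i j, 1 ≤ (M i j).order) : matEval 1 M = 1 := by
  refine (hasSum_matEval 1 hM).unique ?_
  convert hasSum_single 0 fun k hk => ?_
  · simp [matTerm]
  · simp [matTerm, PowerSeries.coeff_one, hk]

lemma matEval_X {M : Matrix (Fin (n + 1)) (Fin (n + 1)) (Series n)}
    (hM : ∀ i j, 1 ≤ (M i j).order) : matEval PowerSeries.X M = M := by
  refine (hasSum_matEval _ hM).unique ?_
  convert hasSum_single 1 fun k hk => ?_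
  · simp [matTerm]
  · simp [matTerm, PowerSeries.coeff_X, hk]

lemma matEval_neg_arg (p : PowerSeries ℂ)
    (M : Matrix (Fin (n + 1)) (Fin (n + 1)) (Series n)) :
    matEval p (-M) = matEval (PowerSeries.rescale (-1) p) M := by
  refine Matrix.ext fun i j => congrArg formalSum (funext fun k => ?_)
  rw [PowerSeries.coeff_rescale, C_smul, C_smul]
  rcases Nat.even_or_odd k with hk | hk <;> simp [hk.neg_one_pow, hk.neg_pow]

lemma commute_matEval (p : PowerSeries ℂ) {M : Matrix (Fin (n + 1)) (Fin (n + 1)) (Series n)}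
    (hM : ∀ i j, 1 ≤ (M i j).order) : M * matEval p M = matEval p M * M := by
  have h := (matEval_mul PowerSeries.X p hM).symm.trans
    ((congrArg (matEval · M) (mul_comm _ p)).trans (matEval_mul p PowerSeries.X hM))
  rwa [matEval_X hM] at h

/-! ### Continuous derivations -/

lemma map_derivation_mul (δ : Derivation Scalars (Series n) (Series n))
    (M N : Matrix (Fin (n + 1)) (Fin (n + 1)) (Series n)) :
    (M * N).map δ = M.map δ * N + M * N.map δ := by
  refine Matrix.ext fun i j => ?_
  simp only [Matrix.map_apply, Matrix.mul_apply, map_sum, Derivation.leibniz, Matrix.add_apply,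
    smul_eq_mul, ← Finset.sum_add_distrib]
  exact Finset.sum_congr rfl fun l _ => by rw [add_comm, mul_comm (N l j)]

lemma map_derivation_pow (δ : Derivation Scalars (Series n) (Series n)) {c : ℂ}
    {M : Matrix (Fin (n + 1)) (Fin (n + 1)) (Series n)}
    (h : M.map δ = scalar n c • M) (k : ℕ) :
    (M ^ k).map δ = scalar n (c * k) • M ^ k := by
  induction k with
  | zero =>
    refine Matrix.ext fun i j => ?_
    by_cases hij : i = j <;> simp [hij]
  | succ k ih =>
    rw [pow_succ, map_derivation_mul, ih, h, Matrix.smul_mul, Matrix.mul_smul, ← add_smul,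
      ← map_add, Nat.cast_succ, mul_add_one]

/-- If a derivation scales `M` by `c` then it sends `p(M)` to `c M p'(M)`. -/
lemma map_derivation_matEval {δ : Derivation Scalars (Series n) (Series n)} (hδ : Continuous δ)
    {c : ℂ} {M : Matrix (Fin (n + 1)) (Fin (n + 1)) (Series n)}
    (hM : ∀ i j, 1 ≤ (M i j).order) (h : M.map δ = scalar n c • M)
    (p : PowerSeries ℂ) :
    (matEval p M).map δ =
      matEval (c • (PowerSeries.X * PowerSeries.derivative ℂ p)) M := by
  refine Matrix.ext fun i j => ?_
  refine HasSum.unique ?_ (Pi.hasSum.1 (Pi.hasSum.1 (hasSum_matEval _ hM) i) j)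
  have h1 := (Pi.hasSum.1 (Pi.hasSum.1 (hasSum_matEval p hM) i) j).map δ hδ
  change HasSum _ (δ (matEval p M i j))
  convert h1 using 2 with k
  have h2 : δ ((M ^ k) i j) = scalar n (c * k) * (M ^ k) i j :=
    congrFun (congrFun (map_derivation_pow δ h k) i) j
  simp only [matTerm, Matrix.smul_apply, Function.comp, smul_eq_mul]
  rw [derivation_scalar_mul, h2, ← mul_assoc, ← map_mul]
  congr 2
  rw [PowerSeries.coeff_smul, smul_eq_mul]
  cases k with
  | zero => simp
  | succ k =>
    rw [PowerSeries.coeff_succ_X_mul, PowerSeries.coeff_derivative]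
    push_cast
    ring

lemma hasSum_expSeries {x : Series n} (hx : MvPowerSeries.constantCoeff x = 0) :
    HasSum (fun k : ℕ => scalar n (k.factorial : ℂ)⁻¹ * x ^ k) (expSeries x) := by
  have h1 : IsFormallySummable (fun k : ℕ => scalar n (k.factorial : ℂ)⁻¹ * x ^ k) :=
    isFormallySummable_of_le_order fun k =>
      (MvPowerSeries.le_order_pow_of_constantCoeff_eq_zero k hx).trans (le_order_scalar_mul _ _)
  convert h1.hasSum
  ext m : 1
  rw [expSeries, PowerSeries.coeff_subst (PowerSeries.HasSubst.of_constantCoeff_zero hx)]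
  refine finsum_congr fun k => ?_
  beta_reduce
  rw [← C_smul, MvPowerSeries.coeff_smul]
  simp [PowerSeries.coeff_exp]

lemma constantCoeff_expSeries {x : Series n} (hx : MvPowerSeries.constantCoeff x = 0) :
    MvPowerSeries.constantCoeff (expSeries x) = 1 := by
  have h := (hasSum_expSeries hx).map MvPowerSeries.constantCoeff
    (MvPowerSeries.WithPiTopology.continuous_constantCoeff _)
  refine h.unique ?_
  convert hasSum_single 0 fun k hk => ?_
  · simp
  · simp [hx, hk]

lemma derivation_expSeries {δ : Derivation Scalars (Series n) (Series n)} (hδ : Continuous δ)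
    {x : Series n} (hx : MvPowerSeries.constantCoeff x = 0) :
    δ (expSeries x) = δ x * expSeries x := by
  have h1 := (hasSum_expSeries hx).map δ hδ
  have h2 := (hasSum_expSeries hx).mul_left (δ x)
  refine h1.unique ((hasSum_nat_add_iff' 1).1 ?_)
  have h3 : (δ ∘ fun k : ℕ => scalar n (k.factorial : ℂ)⁻¹ * x ^ k) 0 = 0 := by
    simp only [Function.comp, derivation_scalar_mul, pow_zero, Derivation.map_one_eq_zero, mul_zero]
  rw [Finset.sum_range_one, h3, sub_zero]
  refine Eq.mpr (congrArg (HasSum · _) (funext fun k => ?_)) h2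
  have h4 : scalar n ((k.factorial : ℂ))⁻¹
      = scalar n (((k + 1).factorial : ℂ)⁻¹) * ((k + 1 : ℕ) : Series n) := by
    rw [← map_natCast (scalar n), ← map_mul]
    congr 1
    rw [Nat.factorial_succ]
    have := Nat.cast_ne_zero (R := ℂ).2 (Nat.factorial_ne_zero k)
    have h' : ((k : ℂ) + 1) ≠ 0 := by exact_mod_cast Nat.succ_ne_zero k
    push_cast
    field_simp
  simp only [Function.comp, derivation_scalar_mul, Derivation.leibniz_pow, smul_eq_mul,
    Nat.add_sub_cancel, nsmul_eq_mul]
  rw [h4]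
  ring

/-! ### The coefficients of the biderivation are Casimir functions -/

lemma pderiv_inCopy (c c' : ℕ) (α : Fin (n + 1)) (p : Poly n) :
    MvPolynomial.pderiv (c, α) (inCopy c' p) =
      if c = c' then inCopy c' (MvPolynomial.pderiv α p) else 0 := by
  split_ifs with h
  · subst h
    exact MvPolynomial.pderiv_rename (f := fun i : Fin (n + 1) => (c, i))
      (fun i j hij => (Prod.mk.inj hij).2) α p
  · classical
    refine MvPolynomial.pderiv_eq_zero_of_notMem_vars fun hmem => ?_
    obtain ⟨i, -, hi⟩ := Finset.mem_image.1 (MvPolynomial.vars_rename _ _ hmem)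
    exact h (Prod.mk.inj hi).1.symm

lemma rename_snd_inCopy (c : ℕ) (p : Poly n) :
    MvPolynomial.rename Prod.snd (inCopy c p) = p := by
  rw [inCopy, MvPolynomial.rename_rename]
  exact MvPolynomial.rename_id_apply p

lemma sum_fin_two_arrow {ι M : Type*} [Fintype ι] [AddCommMonoid M] (F : (Fin 2 → ι) → M) :
    ∑ α, F α = ∑ i, ∑ j, F ![i, j] := by
  rw [← Fintype.sum_prod_type']
  exact Fintype.sum_equiv (finTwoArrowEquiv ι) _ _ fun α => by
    congr 1
    funext i
    fin_cases i <;> rfl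

lemma arrowProduct_two (Λ : Matrix (Fin (n + 1)) (Fin (n + 1)) (Poly n)) (f g : Poly n) :
    arrowProduct Λ 2 f g = ∑ α : Fin 2 → Fin (n + 1), ∑ β : Fin 2 → Fin (n + 1),
      ((∏ i, Λ (α i) (β i)) * iterDeriv α f * iterDeriv β g +
      (Λ (α 0) (β 0) * MvPolynomial.pderiv (β 0) (Λ (α 1) (β 1)) *
          MvPolynomial.pderiv (α 0) (MvPolynomial.pderiv (α 1) f) * MvPolynomial.pderiv (β 1) g +
        MvPolynomial.pderiv (α 1) (Λ (α 0) (β 0)) * Λ (α 1) (β 1) *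
          MvPolynomial.pderiv (α 0) f * MvPolynomial.pderiv (β 0) (MvPolynomial.pderiv (β 1) g) +
        MvPolynomial.pderiv (α 1) (Λ (α 0) (β 0)) * MvPolynomial.pderiv (β 0) (Λ (α 1) (β 1)) *
          MvPolynomial.pderiv (α 0) f * MvPolynomial.pderiv (β 1) g)) := by
  have h1 : Finset.Ioc 1 3 = {2, 3} := rfl
  have h2 : Finset.Ioc 2 3 = {3} := rfl
  refine Finset.sum_congr rfl fun α _ => Finset.sum_congr rfl fun β _ => ?_
  simp [List.ofFn_succ, leftArrow, rightArrow, iterDeriv, Fin.prod_univ_two, h1, h2,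
    Finset.sum_range_succ, pderiv_inCopy, rename_snd_inCopy]
  ring

lemma bracket_X_left (Λ : Matrix (Fin (n + 1)) (Fin (n + 1)) (Poly n)) (a : Fin (n + 1))
    (g : Poly n) :
    bracket Λ (MvPolynomial.X a) g = ∑ β, Λ a β * MvPolynomial.pderiv β g := by
  rw [bracket, Finset.sum_eq_single a]
  · simp
  · intro b _ hb
    simp [MvPolynomial.pderiv_X_of_ne (Ne.symm hb)]
  · simp

lemma bracket_X_X (Λ : Matrix (Fin (n + 1)) (Fin (n + 1)) (Poly n)) (a b : Fin (n + 1)) :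
    bracket Λ (MvPolynomial.X a) (MvPolynomial.X b) = Λ a b := by
  rw [bracket_X_left, Finset.sum_eq_single b]
  · simp
  · intro c _ hc
    simp [MvPolynomial.pderiv_X_of_ne (Ne.symm hc)]
  · simp

lemma IsQuantizable.apply_swap {Λ : Matrix (Fin (n + 1)) (Fin (n + 1)) (Poly n)}
    (hΛ : IsQuantizable Λ) (a b : Fin (n + 1)) : Λ a b = -Λ b a := by
  have h := hΛ.skew (MvPolynomial.X a) (MvPolynomial.X b)
  rwa [bracket_X_X, bracket_X_X] at h

/-- The arrow relation for two factors with a linear function on the right: the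
terms in which a coefficient is differentiated cancel. -/
lemma IsQuantizable.arrow_relation_two_X {Λ : Matrix (Fin (n + 1)) (Fin (n + 1)) (Poly n)}
    (hΛ : IsQuantizable Λ) (f : Poly n) (c : Fin (n + 1)) :
    ∑ a, ∑ b, MvPolynomial.pderiv a (MvPolynomial.pderiv b f) *
        bracket Λ (MvPolynomial.X a) (Λ b c) +
      ∑ a, MvPolynomial.pderiv a f *
        ∑ b, ∑ d, MvPolynomial.pderiv b (Λ a d) * MvPolynomial.pderiv d (Λ b c) = 0 := by
  have h := hΛ.arrow_relation 2 f (MvPolynomial.X c)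
  rw [arrowProduct_two] at h
  simp only [Finset.sum_add_distrib, add_eq_left] at h
  have hg : ∀ i j : Fin (n + 1), MvPolynomial.pderiv i
      (MvPolynomial.pderiv j (MvPolynomial.X c : Poly n)) = 0 := by
    intro i j
    by_cases hj : j = c
    · subst hj; simp
    · simp [MvPolynomial.pderiv_X_of_ne (Ne.symm hj)]
  simp only [hg, mul_zero, Finset.sum_const_zero, add_zero, sum_fin_two_arrow,
    Matrix.cons_val_zero, Matrix.cons_val_one] at h
  have hd : ∀ F : Fin (n + 1) → Poly n, ∑ j, F j * MvPolynomial.pderiv j (MvPolynomial.X c) =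
      F c := by
    intro F
    rw [Finset.sum_eq_single c]
    · simp
    · intro b _ hb
      simp [MvPolynomial.pderiv_X_of_ne (Ne.symm hb)]
    · simp
  simp only [hd] at h
  rw [← h]
  congr 1
  · refine Finset.sum_congr rfl fun a _ => Finset.sum_congr rfl fun b _ => ?_
    rw [bracket_X_left, Finset.mul_sum]
    exact Finset.sum_congr rfl fun d _ => by ring
  · refine Finset.sum_congr rfl fun a _ => ?_
    rw [Finset.mul_sum]
    refine Finset.sum_congr rfl fun b _ => ?_
    rw [Finset.mul_sum]
    exact Finset.sum_congr rfl fun d _ => by ring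

/-- The coefficients `Λ^{bc}` are Casimir functions. The arrow relation makes
`{z_a, Λ^{bc}}` antisymmetric in `a, b`; it is antisymmetric in `b, c` as `Λ` is skew, and then
the Jacobi identity says that three times it vanishes. -/
lemma IsQuantizable.bracket_X_coeff {Λ : Matrix (Fin (n + 1)) (Fin (n + 1)) (Poly n)}
    (hΛ : IsQuantizable Λ) (a b c : Fin (n + 1)) :
    bracket Λ (MvPolynomial.X a) (Λ b c) = 0 := by
  have hsum : ∀ (i : Fin (n + 1)) (F : Fin (n + 1) → Poly n),
      ∑ j, MvPolynomial.pderiv j (MvPolynomial.X i) * F j = F i := by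
    intro i F
    rw [Finset.sum_eq_single i]
    · simp
    · intro j _ hj
      simp [MvPolynomial.pderiv_X_of_ne (Ne.symm hj)]
    · simp
  have hX : ∀ i j k : Fin (n + 1), MvPolynomial.pderiv i
      (MvPolynomial.pderiv j (MvPolynomial.X k : Poly n)) = 0 := by
    intro i j k
    by_cases hj : j = k
    · subst hj; simp
    · simp [MvPolynomial.pderiv_X_of_ne (Ne.symm hj)]
  -- Linear functions: the contraction of the derivatives of two coefficients vanishes.
  have hR : ∀ i k : Fin (n + 1),
      ∑ b, ∑ d, MvPolynomial.pderiv b (Λ i d) * MvPolynomial.pderiv d (Λ b k) = 0 := by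
    intro i k
    have h := hΛ.arrow_relation_two_X (MvPolynomial.X i) k
    simpa only [hX, zero_mul, Finset.sum_const_zero, zero_add, hsum] using h
  have harrow : ∀ i j k : Fin (n + 1), bracket Λ (MvPolynomial.X i) (Λ j k) =
      -bracket Λ (MvPolynomial.X j) (Λ i k) := by
    intro i j k
    have h := hΛ.arrow_relation_two_X (MvPolynomial.X i * MvPolynomial.X j) k
    simp only [hR, mul_zero, Finset.sum_const_zero, add_zero, Derivation.leibniz, smul_eq_mul,
      map_add, hX, zero_add, add_mul, Finset.sum_add_distrib] at h
    have h1 : ∀ p q : Fin (n + 1), ∑ x, ∑ y, MvPolynomial.pderiv y (MvPolynomial.X p : Poly n) *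
        MvPolynomial.pderiv x (MvPolynomial.X q) * bracket Λ (MvPolynomial.X x) (Λ y k) =
        bracket Λ (MvPolynomial.X q) (Λ p k) := by
      intro p q
      simp only [mul_assoc, hsum]
    rw [h1, h1] at h
    linear_combination h
  have hskew : ∀ i j k : Fin (n + 1), bracket Λ (MvPolynomial.X i) (Λ j k) =
      -bracket Λ (MvPolynomial.X i) (Λ k j) := by
    intro i j k
    rw [hΛ.apply_swap j k, bracket_X_left, bracket_X_left]
    simp
  have hj := hΛ.jacobi (MvPolynomial.X a) (MvPolynomial.X b) (MvPolynomial.X c)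
  simp only [bracket_X_X] at hj
  rw [harrow b c a, hskew c b a, harrow c a b, hskew a c b] at hj
  have h3 : (3 : Poly n) * bracket Λ (MvPolynomial.X a) (Λ b c) = 0 := by linear_combination hj
  exact (mul_eq_zero.1 h3).resolve_left (by norm_num)

/-! ### The Euler field and the Hamiltonian fields of the coordinates -/

lemma toSeries_mul (p q : Poly n) : toSeries (p * q) = toSeries p * toSeries q := by
  simp [toSeries]

lemma toSeries_add (p q : Poly n) : toSeries (p + q) = toSeries p + toSeries q := by
  simp [toSeries]

lemma toSeries_neg (p : Poly n) : toSeries (-p) = -toSeries p := by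
  rw [eq_neg_iff_add_eq_zero, ← toSeries_add, neg_add_cancel]
  simp [toSeries]

lemma toSeries_sum {ι : Type*} (s : Finset ι) (p : ι → Poly n) :
    toSeries (∑ i ∈ s, p i) = ∑ i ∈ s, toSeries (p i) := by
  classical
  induction s using Finset.induction_on with
  | empty => simp [toSeries]
  | insert i s hi ih => rw [Finset.sum_insert hi, Finset.sum_insert hi, toSeries_add, ih]

lemma toSeries_C (a : ℂ) : (toSeries (MvPolynomial.C a) : Series n) = scalar n a := by
  simp [toSeries, scalar]

lemma pderiv_toSeries (i : Fin (n + 1)) (p : Poly n) :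
    MvPowerSeries.pderiv Scalars i (toSeries p) = toSeries (MvPolynomial.pderiv i p) := by
  rw [toSeries, MvPowerSeries.pderiv_coe, MvPolynomial.pderiv_map, toSeries]

lemma continuous_pderiv (i : Fin (n + 1)) :
    Continuous (MvPowerSeries.pderiv Scalars i : Series n → Series n) := by
  refine continuous_pi fun m => ?_
  have h : (fun f : Series n => (MvPowerSeries.pderiv Scalars i f) m) =
      fun f => coeff (m + Finsupp.single i 1) f * ((m i : Scalars) + 1) :=
    funext fun f => MvPowerSeries.coeff_pderiv f m
  rw [h]
  exact (MvPowerSeries.WithPiTopology.continuous_coeff Scalars _).mul continuous_const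

lemma sum_smul_pderiv_apply (F : Fin (n + 1) → Series n) (f : Series n) :
    (∑ i, F i • MvPowerSeries.pderiv Scalars i : Derivation Scalars (Series n) (Series n)) f =
      ∑ i, F i * MvPowerSeries.pderiv Scalars i f := by
  have h := congrFun (map_sum (Derivation.coeFnAddMonoidHom (R := Scalars) (A := Series n)
    (M := Series n)) (fun i => F i • MvPowerSeries.pderiv Scalars i) Finset.univ) f
  rw [Finset.sum_apply] at h
  exact h

lemma continuous_sum_smul_pderiv (F : Fin (n + 1) → Series n) :
    Continuous (∑ i, F i • MvPowerSeries.pderiv Scalars i :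
      Derivation Scalars (Series n) (Series n)) := by
  rw [funext (sum_smul_pderiv_apply F)]
  exact continuous_finsetSum _ fun i _ => continuous_const.mul (continuous_pderiv i)

/-- The Euler derivation `∑ zᵢ ∂ᵢ`, which multiplies a homogeneous series by its degree. -/
def euler (n : ℕ) : Derivation Scalars (Series n) (Series n) :=
  ∑ i, (MvPowerSeries.X i : Series n) • MvPowerSeries.pderiv Scalars i

/-- The Hamiltonian derivation `{z_α, ·} = ∑ Λ^{αβ} ∂_β`. -/
def coordField (Λ : Matrix (Fin (n + 1)) (Fin (n + 1)) (Poly n)) (α : Fin (n + 1)) :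
    Derivation Scalars (Series n) (Series n) :=
  ∑ β, toSeries (Λ α β) • MvPowerSeries.pderiv Scalars β

lemma euler_apply (f : Series n) :
    euler n f = ∑ i, MvPowerSeries.X i * MvPowerSeries.pderiv Scalars i f := by
  exact sum_smul_pderiv_apply _ f

lemma coordField_apply (Λ : Matrix (Fin (n + 1)) (Fin (n + 1)) (Poly n)) (α : Fin (n + 1))
    (f : Series n) :
    coordField Λ α f = ∑ β, toSeries (Λ α β) * MvPowerSeries.pderiv Scalars β f := by
  exact sum_smul_pderiv_apply _ f

lemma continuous_euler : Continuous (euler n) := continuous_sum_smul_pderiv _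

lemma continuous_coordField (Λ : Matrix (Fin (n + 1)) (Fin (n + 1)) (Poly n))
    (α : Fin (n + 1)) : Continuous (coordField Λ α) := continuous_sum_smul_pderiv _

lemma coeff_X_mul_pderiv (i : Fin (n + 1)) (f : Series n) (m : Fin (n + 1) →₀ ℕ) :
    coeff m (MvPowerSeries.X i * MvPowerSeries.pderiv Scalars i f) =
      (m i : Scalars) * coeff m f := by
  classical
  rw [MvPowerSeries.X, MvPowerSeries.coeff_monomial_mul]
  split_ifs with h
  · have hi : 1 ≤ m i := by simpa using h i
    rw [MvPowerSeries.coeff_pderiv, tsub_add_cancel_of_le h, one_mul, mul_comm]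
    congr 1
    rw [Finsupp.tsub_apply, Finsupp.single_eq_same, Nat.cast_sub hi, Nat.cast_one, sub_add_cancel]
  · have hi : m i = 0 := by
      by_contra hne
      exact h (Finsupp.single_le_iff.2 (Nat.one_le_iff_ne_zero.2 hne))
    rw [hi, Nat.cast_zero, zero_mul]

lemma coeff_euler (f : Series n) (m : Fin (n + 1) →₀ ℕ) :
    coeff m (euler n f) = (m.degree : Scalars) * coeff m f := by
  rw [euler_apply, map_sum, Finset.sum_congr rfl fun i _ => coeff_X_mul_pderiv i f m,
    ← Finset.sum_mul, ← Nat.cast_sum, Finsupp.degree_eq_sum]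

lemma euler_X (i : Fin (n + 1)) : euler n (MvPowerSeries.X i) = MvPowerSeries.X i := by
  rw [euler_apply, Finset.sum_eq_single i]
  · simp
  · intro j _ hj
    rw [MvPowerSeries.pderiv_X_of_ne (Ne.symm hj), mul_zero]
  · simp

/-- Euler's identity for a homogeneous polynomial. -/
lemma euler_toSeries {d : ℕ} {p : Poly n} (hp : p.IsHomogeneous d) :
    euler n (toSeries p) = (d : Series n) * toSeries p := by
  ext m : 1
  rw [coeff_euler, ← nsmul_eq_mul d, map_nsmul, nsmul_eq_mul]
  by_cases hm : m.degree = d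
  · rw [hm]
  · have h : coeff m (toSeries p) = 0 := by
      rw [toSeries, MvPolynomial.coeff_coe, MvPolynomial.coeff_map, hp.coeff_eq_zero hm, map_zero]
    rw [h, mul_zero, mul_zero]

lemma coordField_X (Λ : Matrix (Fin (n + 1)) (Fin (n + 1)) (Poly n)) (α β : Fin (n + 1)) :
    coordField Λ α (MvPowerSeries.X β) = toSeries (Λ α β) := by
  rw [coordField_apply, Finset.sum_eq_single β]
  · simp
  · intro j _ hj
    rw [MvPowerSeries.pderiv_X_of_ne (Ne.symm hj), mul_zero]
  · simp

lemma IsQuantizable.coordField_coeff {Λ : Matrix (Fin (n + 1)) (Fin (n + 1)) (Poly n)}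
    (hΛ : IsQuantizable Λ) (a b c : Fin (n + 1)) : coordField Λ a (toSeries (Λ b c)) = 0 := by
  have h := hΛ.bracket_X_coeff a b c
  rw [bracket_X_left] at h
  rw [coordField_apply]
  simp only [pderiv_toSeries, ← toSeries_mul]
  rw [← toSeries_sum, h]
  simp [toSeries]

lemma coordField_scalar (Λ : Matrix (Fin (n + 1)) (Fin (n + 1)) (Poly n)) (α : Fin (n + 1))
    (a : ℂ) : coordField Λ α (scalar n a) = 0 :=
  (coordField Λ α).map_algebraMap (HahnSeries.C a)

lemma euler_scalar (a : ℂ) : euler n (scalar n a) = 0 :=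
  (euler n).map_algebraMap (HahnSeries.C a)

lemma euler_pderiv (i : Fin (n + 1)) (f : Series n) :
    euler n (MvPowerSeries.pderiv Scalars i f) =
      MvPowerSeries.pderiv Scalars i (euler n f) - MvPowerSeries.pderiv Scalars i f := by
  ext m : 1
  rw [coeff_euler, map_sub, MvPowerSeries.coeff_pderiv, MvPowerSeries.coeff_pderiv, coeff_euler,
    map_add, Finsupp.degree_single, Nat.cast_add, Nat.cast_one]
  ring

/-- The derivation `{z_α, ·}` raises the degree by one. -/
lemma IsQuantizable.euler_coordField {Λ : Matrix (Fin (n + 1)) (Fin (n + 1)) (Poly n)}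
    (hΛ : IsQuantizable Λ) (α : Fin (n + 1)) (f : Series n) :
    euler n (coordField Λ α f) = coordField Λ α (euler n f) + coordField Λ α f := by
  rw [coordField_apply, coordField_apply, map_sum, ← Finset.sum_add_distrib]
  refine Finset.sum_congr rfl fun β _ => ?_
  rw [Derivation.leibniz, euler_toSeries (hΛ.orderZero α β), euler_pderiv]
  simp only [smul_eq_mul]
  push_cast
  ring

lemma le_order_pderiv {d : ℕ} {f : Series n} (hf : (d : ℕ∞) ≤ f.order) (i : Fin (n + 1)) :
    ((d - 1 : ℕ) : ℕ∞) ≤ (MvPowerSeries.pderiv Scalars i f).order := by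
  refine MvPowerSeries.nat_le_order fun m hm => ?_
  rw [MvPowerSeries.coeff_pderiv, MvPowerSeries.coeff_of_lt_order, zero_mul]
  refine lt_of_lt_of_le (Nat.cast_lt.2 ?_) hf
  rw [map_add, Finsupp.degree_single]
  omega

lemma le_order_sum {ι : Type*} {d : ℕ∞} (s : Finset ι) (F : ι → Series n)
    (h : ∀ i ∈ s, d ≤ (F i).order) : d ≤ (∑ i ∈ s, F i).order := by
  refine MvPowerSeries.le_order fun m hm => ?_
  rw [map_sum]
  exact Finset.sum_eq_zero fun i hi => MvPowerSeries.coeff_of_lt_order (hm.trans_le (h i hi))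

lemma IsQuantizable.le_order_coordField {Λ : Matrix (Fin (n + 1)) (Fin (n + 1)) (Poly n)}
    (hΛ : IsQuantizable Λ) (α : Fin (n + 1)) {d : ℕ} {f : Series n} (hf : (d : ℕ∞) ≤ f.order) :
    ((d + 1 : ℕ) : ℕ∞) ≤ (coordField Λ α f).order := by
  rw [coordField_apply]
  refine le_order_sum _ _ fun β _ => ?_
  refine le_trans ?_ MvPowerSeries.le_order_mul
  refine le_trans ?_ (add_le_add (le_order_toSeries _ (hΛ.orderZero α β)) (le_order_pderiv hf β))
  rw [← Nat.cast_add, Nat.cast_le]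
  omega

/-! ### Star multiplication by a quadratic Hamiltonian -/

/-- The linear form `(A Z)_α`. -/
def linForm (A : Matrix (Fin (n + 1)) (Fin (n + 1)) ℂ) (α : Fin (n + 1)) : Series n :=
  ∑ j, scalar n (A α j) * MvPowerSeries.X j

/-- The operator `f ↦ (1/μ) A[Z] ⋆ f`, written with the derivations `{z_α, ·}`. -/
def hamOp (Λ : Matrix (Fin (n + 1)) (Fin (n + 1)) (Poly n))
    (A : Matrix (Fin (n + 1)) (Fin (n + 1)) ℂ) (f : Series n) : Series n :=
  hamiltonian A * f + ∑ α, linForm A α * coordField Λ α f +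
    ∑ α, ∑ β, MvPowerSeries.C (mu / 4) * scalar n (A α β) * coordField Λ α (coordField Λ β f)

lemma constMat_apply (A : Matrix (Fin (n + 1)) (Fin (n + 1)) ℂ) (i j : Fin (n + 1)) :
    constMat A i j = scalar n (A i j) := toSeries_C _

lemma hamiltonian_eq (A : Matrix (Fin (n + 1)) (Fin (n + 1)) ℂ) :
    hamiltonian A = MvPowerSeries.C mu⁻¹ * ∑ i, MvPowerSeries.X i * linForm A i := by
  rw [hamiltonian, MvPowerSeries.smul_eq_C_mul]
  congr 1
  refine Finset.sum_congr rfl fun i _ => ?_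
  rw [linForm, Finset.mul_sum]
  exact Finset.sum_congr rfl fun j _ => by rw [constMat_apply, mul_assoc]

lemma pderiv_scalar (i : Fin (n + 1)) (a : ℂ) :
    MvPowerSeries.pderiv Scalars i (scalar n a) = 0 :=
  (MvPowerSeries.pderiv Scalars i).map_algebraMap (HahnSeries.C a)

lemma pderiv_linForm (A : Matrix (Fin (n + 1)) (Fin (n + 1)) ℂ) (i α : Fin (n + 1)) :
    MvPowerSeries.pderiv Scalars i (linForm A α) = scalar n (A α i) := by
  rw [linForm, map_sum, Finset.sum_eq_single i]
  · rw [derivation_scalar_mul, MvPowerSeries.pderiv_X_self, mul_one]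
  · intro j _ hj
    rw [derivation_scalar_mul, MvPowerSeries.pderiv_X_of_ne hj, mul_zero]
  · simp

lemma derivation_C_mul (δ : Derivation Scalars (Series n) (Series n)) (a : Scalars)
    (f : Series n) : δ (MvPowerSeries.C a * f) = MvPowerSeries.C a * δ f := by
  rw [← MvPowerSeries.smul_eq_C_mul, Derivation.map_smul, MvPowerSeries.smul_eq_C_mul]

lemma pderiv_hamiltonian {A : Matrix (Fin (n + 1)) (Fin (n + 1)) ℂ} (hA : A.IsSymm)
    (α : Fin (n + 1)) :
    MvPowerSeries.pderiv Scalars α (hamiltonian A) =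
      MvPowerSeries.C mu⁻¹ * (2 * linForm A α) := by
  rw [hamiltonian_eq, derivation_C_mul, map_sum]
  congr 1
  simp only [Derivation.leibniz, pderiv_linForm, smul_eq_mul, Finset.sum_add_distrib]
  rw [Finset.sum_eq_single (s := Finset.univ) (f := fun x => linForm A x *
    MvPowerSeries.pderiv Scalars α (MvPowerSeries.X x)) α]
  · rw [MvPowerSeries.pderiv_X_self, mul_one, two_mul]
    congr 1
    exact Finset.sum_congr rfl fun j _ => by rw [mul_comm, hA.apply]
  · intro j _ hj
    rw [MvPowerSeries.pderiv_X_of_ne hj, mul_zero]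
  · simp

lemma iterDerivSeries_succ {k : ℕ} (α : Fin (k + 1) → Fin (n + 1)) (f : Series n) :
    iterDerivSeries α f =
      MvPowerSeries.pderiv Scalars (α 0) (iterDerivSeries (fun i => α i.succ) f) := by
  rw [iterDerivSeries, List.ofFn_succ, List.foldr_cons, iterDerivSeries]

lemma iterDerivSeries_castSucc {k : ℕ} (α : Fin (k + 1) → Fin (n + 1)) (f : Series n) :
    iterDerivSeries α f =
      iterDerivSeries (fun i => α i.castSucc)
        (MvPowerSeries.pderiv Scalars (α (Fin.last k)) f) := by
  rw [iterDerivSeries, List.ofFn_succ', List.concat_eq_append, List.foldr_append, iterDerivSeries]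
  rfl

lemma iterDerivSeries_zero {k : ℕ} (α : Fin k → Fin (n + 1)) :
    iterDerivSeries α (0 : Series n) = 0 := by
  induction k with
  | zero => rfl
  | succ k ih => rw [iterDerivSeries_succ, ih, map_zero]

lemma iterDerivSeries_hamiltonian {A : Matrix (Fin (n + 1)) (Fin (n + 1)) ℂ} (hA : A.IsSymm)
    {k : ℕ} (α : Fin (k + 3) → Fin (n + 1)) : iterDerivSeries α (hamiltonian A) = 0 := by
  rw [iterDerivSeries_castSucc, iterDerivSeries_castSucc, iterDerivSeries_castSucc,
    pderiv_hamiltonian hA, derivation_C_mul, two_mul, map_add, pderiv_linForm, derivation_C_mul,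
    map_add, pderiv_scalar, add_zero, mul_zero, iterDerivSeries_zero]

lemma sum_fin_one_arrow {ι M : Type*} [Fintype ι] [AddCommMonoid M] (F : (Fin 1 → ι) → M) :
    ∑ α, F α = ∑ i, F ![i] :=
  Fintype.sum_equiv (Equiv.funUnique (Fin 1) ι) _ _ fun α => by
    congr 1
    funext i
    fin_cases i
    rfl

lemma mu_ne_zero : mu ≠ 0 := HahnSeries.single_ne_zero one_ne_zero

lemma natCast_ne_zero_scalars {k : ℕ} (hk : k ≠ 0) : (k : Scalars) ≠ 0 := by
  rw [← map_natCast (HahnSeries.C : ℂ →+* Scalars)]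
  exact HahnSeries.C_ne_zero (Nat.cast_ne_zero.2 hk)

lemma starTerm_zero (Λ : Matrix (Fin (n + 1)) (Fin (n + 1)) (Poly n)) (f g : Series n) :
    starTerm Λ f g 0 = f * g := by
  rw [starTerm]
  simp [iterDerivSeries]

lemma starTerm_one (Λ : Matrix (Fin (n + 1)) (Fin (n + 1)) (Poly n))
    {A : Matrix (Fin (n + 1)) (Fin (n + 1)) ℂ} (hA : A.IsSymm) (f : Series n) :
    starTerm Λ (hamiltonian A) f 1 = ∑ α, linForm A α * coordField Λ α f := by
  have h2 : (2 : Scalars) ≠ 0 := by exact_mod_cast natCast_ne_zero_scalars two_ne_zero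
  rw [starTerm, sum_fin_one_arrow, Finset.smul_sum]
  refine Finset.sum_congr rfl fun α _ => ?_
  rw [sum_fin_one_arrow, coordField_apply, Finset.mul_sum, Finset.smul_sum]
  refine Finset.sum_congr rfl fun β _ => ?_
  have hi : ∀ (i : Fin (n + 1)) (u : Series n),
      iterDerivSeries ![i] u = MvPowerSeries.pderiv Scalars i u := fun i u => by
    simp [iterDerivSeries]
  have hc : (MvPowerSeries.C ((((1 : ℕ).factorial : Scalars))⁻¹ * (mu / 2) ^ 1) : Series n) *
      MvPowerSeries.C mu⁻¹ * 2 = 1 := by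
    rw [show (2 : Series n) = MvPowerSeries.C (2 : Scalars) from (map_ofNat _ 2).symm, ← map_mul,
      ← map_mul, ← map_one MvPowerSeries.C]
    congr 1
    have := mu_ne_zero
    rw [Nat.factorial_one, Nat.cast_one]
    field_simp
  rw [hi, hi, Fin.prod_univ_one, pderiv_hamiltonian hA, MvPowerSeries.smul_eq_C_mul]
  simp only [Matrix.cons_val_zero]
  linear_combination (toSeries (Λ α β) * linForm A α * MvPowerSeries.pderiv Scalars β f) * hc

lemma IsQuantizable.coordField_coordField {Λ : Matrix (Fin (n + 1)) (Fin (n + 1)) (Poly n)}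
    (hΛ : IsQuantizable Λ) (a b : Fin (n + 1)) (f : Series n) :
    coordField Λ a (coordField Λ b f) = ∑ i, ∑ j, toSeries (Λ a i) * toSeries (Λ b j) *
      MvPowerSeries.pderiv Scalars i (MvPowerSeries.pderiv Scalars j f) := by
  rw [coordField_apply Λ b, map_sum, Finset.sum_comm]
  refine Finset.sum_congr rfl fun j _ => ?_
  rw [Derivation.leibniz, hΛ.coordField_coeff, smul_zero, add_zero, coordField_apply, smul_eq_mul,
    Finset.mul_sum]
  exact Finset.sum_congr rfl fun i _ => by ring

lemma IsQuantizable.starTerm_two {Λ : Matrix (Fin (n + 1)) (Fin (n + 1)) (Poly n)}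
    (hΛ : IsQuantizable Λ) {A : Matrix (Fin (n + 1)) (Fin (n + 1)) ℂ} (hA : A.IsSymm)
    (f : Series n) :
    starTerm Λ (hamiltonian A) f 2 = ∑ α, ∑ β,
      MvPowerSeries.C (mu / 4) * scalar n (A α β) * coordField Λ α (coordField Λ β f) := by
  have h2 : (2 : Scalars) ≠ 0 := by exact_mod_cast natCast_ne_zero_scalars two_ne_zero
  rw [starTerm, sum_fin_two_arrow, Finset.smul_sum]
  refine Finset.sum_congr rfl fun a _ => ?_
  rw [Finset.smul_sum]
  refine Finset.sum_congr rfl fun b _ => ?_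
  rw [sum_fin_two_arrow, hΛ.coordField_coordField, Finset.mul_sum, Finset.smul_sum]
  refine Finset.sum_congr rfl fun i _ => ?_
  rw [Finset.mul_sum, Finset.smul_sum]
  refine Finset.sum_congr rfl fun j _ => ?_
  have hi : ∀ (i j : Fin (n + 1)) (u : Series n), iterDerivSeries ![i, j] u =
      MvPowerSeries.pderiv Scalars i (MvPowerSeries.pderiv Scalars j u) := fun i j u => by
    simp [iterDerivSeries, List.ofFn_succ]
  have hc : (MvPowerSeries.C ((((2 : ℕ).factorial : Scalars))⁻¹ * (mu / 2) ^ 2) : Series n) *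
      MvPowerSeries.C mu⁻¹ * 2 = MvPowerSeries.C (mu / 4) := by
    rw [show (2 : Series n) = MvPowerSeries.C (2 : Scalars) from (map_ofNat _ 2).symm, ← map_mul,
      ← map_mul]
    congr 1
    have := mu_ne_zero
    rw [Nat.factorial_two, Nat.cast_two, show (4 : Scalars) = 2 * 2 by norm_num]
    field_simp
  rw [hi, hi, Fin.prod_univ_two, pderiv_hamiltonian hA, derivation_C_mul, two_mul, map_add,
    pderiv_linForm, hA.apply, MvPowerSeries.smul_eq_C_mul]
  simp only [Matrix.cons_val_zero, Matrix.cons_val_one]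
  linear_combination (toSeries (Λ a i) * toSeries (Λ b j) * scalar n (A a b) *
    MvPowerSeries.pderiv Scalars i (MvPowerSeries.pderiv Scalars j f)) * hc

/-- The star product by a quadratic form stops after the second term, and as the derivations
`{z_α, ·}` kill the coefficients of `Λ`, the second term is a second power of them. -/
lemma IsQuantizable.star_hamiltonian {Λ : Matrix (Fin (n + 1)) (Fin (n + 1)) (Poly n)}
    (hΛ : IsQuantizable Λ) {A : Matrix (Fin (n + 1)) (Fin (n + 1)) ℂ} (hA : A.IsSymm)
    (f : Series n) : star Λ (hamiltonian A) f = hamOp Λ A f := by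
  refine (summable_starTerm Λ hΛ.orderZero (hamiltonian A) f).hasSum.unique ?_
  have h : HasSum (starTerm Λ (hamiltonian A) f)
      (∑ k ∈ Finset.range 3, starTerm Λ (hamiltonian A) f k) := by
    refine hasSum_sum_of_ne_finset_zero fun k hk => ?_
    obtain ⟨l, rfl⟩ : ∃ l, k = l + 3 := ⟨k - 3, by
      rw [Finset.mem_range] at hk
      omega⟩
    rw [starTerm]
    simp only [iterDerivSeries_hamiltonian hA, mul_zero, zero_mul, Finset.sum_const_zero,
      smul_zero]
  rwa [Finset.sum_range_succ, Finset.sum_range_succ, Finset.sum_range_one, starTerm_zero,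
    starTerm_one Λ hA, hΛ.starTerm_two hA] at h

lemma hamOp_add (Λ : Matrix (Fin (n + 1)) (Fin (n + 1)) (Poly n))
    (A : Matrix (Fin (n + 1)) (Fin (n + 1)) ℂ) (f g : Series n) :
    hamOp Λ A (f + g) = hamOp Λ A f + hamOp Λ A g := by
  simp only [hamOp, map_add, mul_add, Finset.sum_add_distrib]
  ring

lemma hamOp_C_mul (Λ : Matrix (Fin (n + 1)) (Fin (n + 1)) (Poly n))
    (A : Matrix (Fin (n + 1)) (Fin (n + 1)) ℂ) (a : Scalars) (f : Series n) :
    hamOp Λ A (MvPowerSeries.C a * f) = MvPowerSeries.C a * hamOp Λ A f := by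
  simp only [hamOp, derivation_C_mul, mul_add, Finset.mul_sum, mul_left_comm _ (MvPowerSeries.C a)]

lemma continuous_hamOp (Λ : Matrix (Fin (n + 1)) (Fin (n + 1)) (Poly n))
    (A : Matrix (Fin (n + 1)) (Fin (n + 1)) ℂ) : Continuous (hamOp Λ A) := by
  refine ((continuous_const.mul continuous_id).add (continuous_finsetSum _ fun α _ =>
    continuous_const.mul (continuous_coordField Λ α))).add
      (continuous_finsetSum _ fun α _ => continuous_finsetSum _ fun β _ =>
        continuous_const.mul ((continuous_coordField Λ α).comp (continuous_coordField Λ β)))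

lemma one_le_order_X (i : Fin (n + 1)) : 1 ≤ (MvPowerSeries.X i : Series n).order :=
  MvPowerSeries.one_le_order_iff_constCoeff_eq_zero.2 (MvPowerSeries.constantCoeff_X i)

lemma one_le_order_linForm (A : Matrix (Fin (n + 1)) (Fin (n + 1)) ℂ) (α : Fin (n + 1)) :
    1 ≤ (linForm A α).order :=
  le_order_sum _ _ fun j _ => (one_le_order_X j).trans (le_order_scalar_mul _ _)

lemma le_order_C_mul (a : Scalars) (f : Series n) : f.order ≤ (MvPowerSeries.C a * f).order := by
  rw [← MvPowerSeries.smul_eq_C_mul]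
  exact MvPowerSeries.le_order_smul

lemma two_le_order_hamiltonian (A : Matrix (Fin (n + 1)) (Fin (n + 1)) ℂ) :
    2 ≤ (hamiltonian A : Series n).order := by
  rw [hamiltonian_eq]
  refine le_trans (le_order_sum _ _ fun i _ => ?_) (le_order_C_mul _ _)
  exact le_trans (add_le_add (one_le_order_X i) (one_le_order_linForm A i))
    MvPowerSeries.le_order_mul

/-- Star multiplication by a quadratic form raises the order by two: each derivation is
accompanied by a quadratic coefficient. -/
lemma IsQuantizable.le_order_hamOp {Λ : Matrix (Fin (n + 1)) (Fin (n + 1)) (Poly n)}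
    (hΛ : IsQuantizable Λ) (A : Matrix (Fin (n + 1)) (Fin (n + 1)) ℂ) {d : ℕ} {f : Series n}
    (hf : (d : ℕ∞) ≤ f.order) : ((d + 2 : ℕ) : ℕ∞) ≤ (hamOp Λ A f).order := by
  have hadd : ∀ {u v : Series n} {e : ℕ∞}, e ≤ u.order → e ≤ v.order → e ≤ (u + v).order :=
    fun hu hv => (le_min hu hv).trans MvPowerSeries.min_order_le_add
  have h1 := hΛ.le_order_coordField
  refine hadd (hadd ?_ (le_order_sum _ _ fun α _ => ?_))
    (le_order_sum _ _ fun α _ => le_order_sum _ _ fun β _ => ?_)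
  · refine le_trans ?_ MvPowerSeries.le_order_mul
    rw [Nat.cast_add, add_comm]
    exact add_le_add (two_le_order_hamiltonian A) hf
  · refine le_trans ?_ MvPowerSeries.le_order_mul
    refine le_trans ?_ (add_le_add (one_le_order_linForm A α) (h1 α hf))
    rw [← Nat.cast_one, ← Nat.cast_add, Nat.cast_le]
    omega
  · rw [mul_assoc]
    exact (h1 α (h1 β hf)).trans ((le_order_scalar_mul _ _).trans (le_order_C_mul _ _))

lemma euler_C_mul (a : Scalars) (f : Series n) :
    euler n (MvPowerSeries.C a * f) = MvPowerSeries.C a * euler n f := derivation_C_mul _ _ _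

lemma euler_linForm (A : Matrix (Fin (n + 1)) (Fin (n + 1)) ℂ) (α : Fin (n + 1)) :
    euler n (linForm A α) = linForm A α := by
  rw [linForm, map_sum]
  exact Finset.sum_congr rfl fun j _ => by rw [derivation_scalar_mul, euler_X]

lemma euler_hamiltonian (A : Matrix (Fin (n + 1)) (Fin (n + 1)) ℂ) :
    euler n (hamiltonian A) = 2 * hamiltonian A := by
  rw [hamiltonian_eq, euler_C_mul, map_sum, mul_left_comm]
  congr 1
  rw [Finset.mul_sum]
  refine Finset.sum_congr rfl fun i _ => ?_
  rw [Derivation.leibniz, euler_X, euler_linForm, smul_eq_mul, smul_eq_mul]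
  ring

/-- Star multiplication by a quadratic form raises the degree by two. -/
lemma IsQuantizable.euler_hamOp {Λ : Matrix (Fin (n + 1)) (Fin (n + 1)) (Poly n)}
    (hΛ : IsQuantizable Λ) (A : Matrix (Fin (n + 1)) (Fin (n + 1)) ℂ) (f : Series n) :
    euler n (hamOp Λ A f) = hamOp Λ A (euler n f) + 2 * hamOp Λ A f := by
  simp only [hamOp, map_add, map_sum, Derivation.leibniz (euler n) (hamiltonian A),
    Derivation.leibniz (euler n) (linForm A _), mul_assoc, euler_C_mul, derivation_scalar_mul,
    euler_linForm, euler_hamiltonian, hΛ.euler_coordField, smul_eq_mul, mul_add,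
    Finset.sum_add_distrib]
  have h1 : ∀ α, (coordField Λ α f) * linForm A α = linForm A α * coordField Λ α f :=
    fun α => mul_comm _ _
  simp only [h1]
  ring

/-! ### The star exponential and its Euler equation -/

/-- A homogeneous equation that determines the star exponential: a series without constant term
vanishes if the Euler field acts on it as twice an operator which raises the order. -/
lemma IsQuantizable.eq_zero_of_euler_eq {Λ : Matrix (Fin (n + 1)) (Fin (n + 1)) (Poly n)}
    (hΛ : IsQuantizable Λ) (A : Matrix (Fin (n + 1)) (Fin (n + 1)) ℂ) {f : Series n}
    (h0 : MvPowerSeries.constantCoeff f = 0) (hf : euler n f = 2 * hamOp Λ A f) : f = 0 := by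
  have key : ∀ d : ℕ, (d : ℕ∞) ≤ f.order := by
    intro d
    induction d with
    | zero => simp
    | succ d ih =>
      refine MvPowerSeries.nat_le_order fun m hm => ?_
      by_cases hm0 : m.degree = 0
      · rw [(Finsupp.degree_eq_zero_iff m).1 hm0]
        exact h0
      · have h1 : coeff m (euler n f) = 0 := by
          rw [hf, two_mul, map_add, MvPowerSeries.coeff_of_lt_order, add_zero]
          refine lt_of_lt_of_le (Nat.cast_lt.2 ?_) (hΛ.le_order_hamOp A ih)
          omega
        rw [coeff_euler] at h1
        exact (mul_eq_zero.1 h1).resolve_left (natCast_ne_zero_scalars hm0)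
  rw [← MvPowerSeries.order_eq_top_iff]
  exact ENat.eq_top_iff_forall_ge.2 key

variable {Λ : Matrix (Fin (n + 1)) (Fin (n + 1)) (Poly n)}
  {A : Matrix (Fin (n + 1)) (Fin (n + 1)) ℂ}

lemma hasSum_hamOp {u : ℕ → Series n} {f : Series n} (h : HasSum u f) :
    HasSum (fun k => hamOp Λ A (u k)) (hamOp Λ A f) :=
  h.map (⟨⟨hamOp Λ A, by simpa using hamOp_C_mul Λ A 0 0⟩, hamOp_add Λ A⟩ : Series n →+ Series n)
    (continuous_hamOp Λ A)

lemma starExpTerm_zero (f : Series n) : starExpTerm Λ f 0 = 1 := by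
  simp [starExpTerm, starPow]

lemma IsQuantizable.starPow_succ (hΛ : IsQuantizable Λ) (hA : A.IsSymm) (k : ℕ) :
    starPow Λ (hamiltonian A) (k + 1) = hamOp Λ A (starPow Λ (hamiltonian A) k) :=
  hΛ.star_hamiltonian hA _

lemma IsQuantizable.hamOp_starExpTerm (hΛ : IsQuantizable Λ) (hA : A.IsSymm) (k : ℕ) :
    hamOp Λ A (starExpTerm Λ (hamiltonian A) k) =
      ((k + 1 : ℕ) : Series n) * starExpTerm Λ (hamiltonian A) (k + 1) := by
  rw [starExpTerm, starExpTerm, MvPowerSeries.smul_eq_C_mul, MvPowerSeries.smul_eq_C_mul,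
    hamOp_C_mul, hΛ.starPow_succ hA, ← mul_assoc, ← map_natCast MvPowerSeries.C, ← map_mul]
  congr 2
  have h1 := natCast_ne_zero_scalars k.factorial_ne_zero
  have h2 := natCast_ne_zero_scalars k.succ_ne_zero
  rw [Nat.factorial_succ, Nat.cast_mul, mul_inv, ← mul_assoc, mul_inv_cancel₀ h2, one_mul]

lemma IsQuantizable.euler_starPow (hΛ : IsQuantizable Λ) (hA : A.IsSymm) (k : ℕ) :
    euler n (starPow Λ (hamiltonian A) k) =
      ((2 * k : ℕ) : Series n) * starPow Λ (hamiltonian A) k := by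
  induction k with
  | zero => rw [starPow, Derivation.map_one_eq_zero, mul_zero, Nat.cast_zero, zero_mul]
  | succ k ih =>
    rw [hΛ.starPow_succ hA, hΛ.euler_hamOp, ih, ← map_natCast MvPowerSeries.C, hamOp_C_mul,
      map_natCast, ← add_mul]
    congr 1
    push_cast
    ring

lemma IsQuantizable.euler_starExpTerm (hΛ : IsQuantizable Λ) (hA : A.IsSymm) (k : ℕ) :
    euler n (starExpTerm Λ (hamiltonian A) k) =
      2 * ((k : Series n) * starExpTerm Λ (hamiltonian A) k) := by
  rw [starExpTerm, Derivation.map_smul, hΛ.euler_starPow hA, MvPowerSeries.smul_eq_C_mul,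
    MvPowerSeries.smul_eq_C_mul]
  push_cast
  ring

lemma IsQuantizable.le_order_starExpTerm (hΛ : IsQuantizable Λ) (hA : A.IsSymm) (k : ℕ) :
    ((2 * k : ℕ) : ℕ∞) ≤ (starExpTerm Λ (hamiltonian A) k).order := by
  refine le_trans ?_ MvPowerSeries.le_order_smul
  induction k with
  | zero => simp
  | succ k ih =>
    rw [hΛ.starPow_succ hA]
    exact hΛ.le_order_hamOp A ih

lemma IsQuantizable.summable_starExpTerm (hΛ : IsQuantizable Λ) (hA : A.IsSymm) :
    IsFormallySummable (starExpTerm Λ (hamiltonian A)) :=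
  isFormallySummable_of_le_order fun k =>
    le_trans (Nat.cast_le.2 (by omega)) (hΛ.le_order_starExpTerm hA k)

lemma IsQuantizable.hasSum_starExp (hΛ : IsQuantizable Λ) (hA : A.IsSymm) :
    HasSum (starExpTerm Λ (hamiltonian A)) (starExp Λ (hamiltonian A)) :=
  (hΛ.summable_starExpTerm hA).hasSum

lemma IsQuantizable.hasSum_hamOp_starExp (hΛ : IsQuantizable Λ) (hA : A.IsSymm) :
    HasSum (fun k : ℕ => ((k + 1 : ℕ) : Series n) * starExpTerm Λ (hamiltonian A) (k + 1))
      (hamOp Λ A (starExp Λ (hamiltonian A))) := by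
  exact Eq.mpr (congrArg (HasSum · _) (funext fun k => (hΛ.hamOp_starExpTerm hA k).symm))
    (hasSum_hamOp (hΛ.hasSum_starExp hA))

lemma IsQuantizable.euler_starExp (hΛ : IsQuantizable Λ) (hA : A.IsSymm) :
    euler n (starExp Λ (hamiltonian A)) = 2 * hamOp Λ A (starExp Λ (hamiltonian A)) := by
  refine ((hΛ.hasSum_starExp hA).map (euler n) continuous_euler).unique
    ((hasSum_nat_add_iff' 1).1 ?_)
  rw [Finset.sum_range_one, Function.comp, hΛ.euler_starExpTerm hA, Nat.cast_zero, zero_mul,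
    mul_zero, sub_zero]
  refine Eq.mpr (congrArg (HasSum · _) (funext fun k => ?_))
    ((hΛ.hasSum_hamOp_starExp hA).mul_left 2)
  exact hΛ.euler_starExpTerm hA (k + 1)

lemma IsQuantizable.constantCoeff_starExp (hΛ : IsQuantizable Λ) (hA : A.IsSymm) :
    MvPowerSeries.constantCoeff (starExp Λ (hamiltonian A)) = 1 := by
  refine ((hΛ.hasSum_starExp hA).map MvPowerSeries.constantCoeff
    (MvPowerSeries.WithPiTopology.continuous_constantCoeff _)).unique ?_
  convert hasSum_single (f := MvPowerSeries.constantCoeff ∘ starExpTerm Λ (hamiltonian A)) 0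
    fun k hk => ?_
  · simp [starExpTerm_zero]
  · rw [Function.comp, ← MvPowerSeries.coeff_zero_eq_constantCoeff_apply]
    refine MvPowerSeries.coeff_of_lt_order (lt_of_lt_of_le ?_ (hΛ.le_order_starExpTerm hA k))
    rw [Finsupp.degree.map_zero, Nat.cast_lt]
    omega

/-! ### The evolution equation -/

lemma linForm_smul (t : ℂ) (α : Fin (n + 1)) : linForm (t • A) α = scalar n t * linForm A α := by
  rw [linForm, linForm, Finset.mul_sum]
  refine Finset.sum_congr rfl fun j _ => ?_
  rw [Matrix.smul_apply, smul_eq_mul, map_mul, mul_assoc]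

lemma hamiltonian_smul (t : ℂ) : hamiltonian (t • A) = scalar n t * hamiltonian A := by
  simp only [hamiltonian_eq, linForm_smul, Finset.mul_sum]
  exact Finset.sum_congr rfl fun i _ => by ring

lemma hamOp_smul (t : ℂ) (f : Series n) : hamOp Λ (t • A) f = scalar n t * hamOp Λ A f := by
  simp only [hamOp, hamiltonian_smul, linForm_smul, Matrix.smul_apply, smul_eq_mul, map_mul,
    mul_add, Finset.mul_sum, mul_assoc, mul_left_comm (MvPowerSeries.C _) (scalar n t)]

lemma IsQuantizable.starExpTerm_smul (hΛ : IsQuantizable Λ) (hA : A.IsSymm) (t : ℂ) (k : ℕ) :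
    starExpTerm Λ (hamiltonian (t • A)) k =
      scalar n (t ^ k) * starExpTerm Λ (hamiltonian A) k := by
  have h : starPow Λ (hamiltonian (t • A)) k =
      scalar n (t ^ k) * starPow Λ (hamiltonian A) k := by
    induction k with
    | zero => rw [pow_zero, map_one, one_mul, starPow, starPow]
    | succ k ih =>
      have hc : ∀ f, hamOp Λ A (scalar n (t ^ k) * f) = scalar n (t ^ k) * hamOp Λ A f :=
        hamOp_C_mul Λ A (HahnSeries.C (t ^ k))
      rw [hΛ.starPow_succ (hA.smul t), hΛ.starPow_succ hA, ih, hamOp_smul, hc, ← mul_assoc,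
        ← map_mul, pow_succ']
  rw [starExpTerm, starExpTerm, h, MvPowerSeries.smul_eq_C_mul, MvPowerSeries.smul_eq_C_mul,
    mul_left_comm]

/-- The coefficients of a sum of terms of growing order, as finite sums. -/
lemma coeff_eq_sum_of_hasSum {u : ℕ → Series n} {f : Series n} (h : HasSum u f)
    (hu : ∀ k : ℕ, (k : ℕ∞) ≤ (u k).order) (m : Fin (n + 1) →₀ ℕ) (N : ℕ) (hN : m.degree < N) :
    coeff m f = ∑ k ∈ Finset.range N, coeff m (u k) := by
  refine (MvPowerSeries.WithPiTopology.hasSum_iff_hasSum_coeff.1 h m).unique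
    (hasSum_sum_of_ne_finset_zero fun k hk => ?_)
  rw [Finset.mem_range, not_lt] at hk
  exact MvPowerSeries.coeff_of_lt_order
    (lt_of_lt_of_le (Nat.cast_lt.2 (lt_of_lt_of_le hN hk)) (hu k))

lemma coeff_scalar_mul_coeff (a : ℂ) (f : Series n) (m : Fin (n + 1) →₀ ℕ) (j : ℤ) :
    (coeff m (scalar n a * f)).coeff j = a * (coeff m f).coeff j := by
  rw [scalar, RingHom.comp_apply, MvPowerSeries.coeff_C_mul, HahnSeries.C_mul_eq_smul,
    HahnSeries.coeff_smul, smul_eq_mul]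

/-- The coefficients of `e_⋆^{(t/μ) A[Z]}` are polynomials in `t`. -/
lemma IsQuantizable.coeff_starExp_smul (hΛ : IsQuantizable Λ) (hA : A.IsSymm) (t : ℂ)
    (m : Fin (n + 1) →₀ ℕ) (j : ℤ) (N : ℕ) (hN : m.degree < N) :
    (coeff m (starExp Λ (hamiltonian (t • A)))).coeff j =
      ∑ k ∈ Finset.range N, t ^ k * (coeff m (starExpTerm Λ (hamiltonian A) k)).coeff j := by
  rw [coeff_eq_sum_of_hasSum (hΛ.hasSum_starExp (hA.smul t)) (fun k =>
    le_trans (Nat.cast_le.2 (by omega)) (hΛ.le_order_starExpTerm (hA.smul t) k)) m N hN,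
    HahnSeries.coeff_sum]
  refine Finset.sum_congr rfl fun k _ => ?_
  rw [hΛ.starExpTerm_smul hA, coeff_scalar_mul_coeff]

lemma IsQuantizable.coeff_hamOp_starExp_smul (hΛ : IsQuantizable Λ) (hA : A.IsSymm) (t : ℂ)
    (m : Fin (n + 1) →₀ ℕ) (j : ℤ) (N : ℕ) (hN : m.degree < N) :
    (coeff m (hamOp Λ A (starExp Λ (hamiltonian (t • A))))).coeff j =
      ∑ k ∈ Finset.range N,
        (k + 1) * t ^ k * (coeff m (starExpTerm Λ (hamiltonian A) (k + 1))).coeff j := by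
  have hc : ∀ k f, hamOp Λ A (scalar n (t ^ k) * f) = scalar n (t ^ k) * hamOp Λ A f :=
    fun k f => hamOp_C_mul Λ A (HahnSeries.C (t ^ k)) f
  rw [coeff_eq_sum_of_hasSum (hasSum_hamOp (hΛ.hasSum_starExp (hA.smul t)))
    (fun k => le_trans (Nat.cast_le.2 (by omega))
      (hΛ.le_order_hamOp A (hΛ.le_order_starExpTerm (hA.smul t) k))) m N hN,
    HahnSeries.coeff_sum]
  refine Finset.sum_congr rfl fun k _ => ?_
  rw [hΛ.starExpTerm_smul hA, hc, coeff_scalar_mul_coeff, hΛ.hamOp_starExpTerm hA,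
    ← map_natCast (scalar n), coeff_scalar_mul_coeff]
  push_cast
  ring

lemma IsQuantizable.hasDerivAt_starExp (hΛ : IsQuantizable Λ) (hA : A.IsSymm) (t : ℂ)
    (m : Fin (n + 1) →₀ ℕ) (j : ℤ) :
    HasDerivAt (fun t : ℂ => (coeff m (starExp Λ (hamiltonian (t • A)))).coeff j)
      ((coeff m (hamOp Λ A (starExp Λ (hamiltonian (t • A))))).coeff j) t := by
  have h1 : (fun t : ℂ => (coeff m (starExp Λ (hamiltonian (t • A)))).coeff j) =
      fun t => ∑ k ∈ Finset.range (m.degree + 2),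
        t ^ k * (coeff m (starExpTerm Λ (hamiltonian A) k)).coeff j :=
    funext fun t => hΛ.coeff_starExp_smul hA t m j _ (by omega)
  rw [h1, hΛ.coeff_hamOp_starExp_smul hA t m j (m.degree + 1) (by omega)]
  have h2 := HasDerivAt.fun_sum (u := Finset.range (m.degree + 2)) fun k _ =>
    (hasDerivAt_pow k t).mul_const ((coeff m (starExpTerm Λ (hamiltonian A) k)).coeff j)
  rw [Finset.sum_range_succ'] at h2
  simpa using h2

lemma IsQuantizable.starExp_zero_smul (hΛ : IsQuantizable Λ) (hA : A.IsSymm) :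
    starExp Λ (hamiltonian ((0 : ℂ) • A)) = 1 := by
  refine (hΛ.hasSum_starExp (hA.smul 0)).unique ?_
  convert hasSum_single 0 fun k hk => ?_
  · rw [starExpTerm_zero]
  · rw [hΛ.starExpTerm_smul hA, zero_pow hk, map_zero, zero_mul]

/-- Uniqueness for the evolution equation: as the right hand side raises the order, the
coefficients of the difference of two solutions are constant, degree after degree. -/
lemma IsQuantizable.eq_of_hasDerivAt (hΛ : IsQuantizable Λ) {F G : ℂ → Series n}
    (h0 : F 0 = G 0)
    (hF : ∀ (t : ℂ) (m : Fin (n + 1) →₀ ℕ) (j : ℤ),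
      HasDerivAt (fun t => (coeff m (F t)).coeff j) ((coeff m (hamOp Λ A (F t))).coeff j) t)
    (hG : ∀ (t : ℂ) (m : Fin (n + 1) →₀ ℕ) (j : ℤ),
      HasDerivAt (fun t => (coeff m (G t)).coeff j) ((coeff m (hamOp Λ A (G t))).coeff j) t)
    (t : ℂ) : F t = G t := by
  have key : ∀ (d : ℕ) (t : ℂ), (d : ℕ∞) ≤ (F t - G t).order := by
    intro d
    induction d with
    | zero => simp
    | succ d ih =>
      intro t
      refine MvPowerSeries.nat_le_order fun m hm => ?_
      ext j
      have hd : ∀ s : ℂ, HasDerivAt (fun t => (coeff m (F t)).coeff j - (coeff m (G t)).coeff j)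
          0 s := by
        intro s
        have h1 := (hF s m j).sub (hG s m j)
        have h2 : coeff m (hamOp Λ A (F s)) = coeff m (hamOp Λ A (G s)) := by
          have h3 : hamOp Λ A (F s) = hamOp Λ A (F s - G s) + hamOp Λ A (G s) := by
            rw [← hamOp_add, sub_add_cancel]
          rw [h3, map_add, MvPowerSeries.coeff_of_lt_order, zero_add]
          refine lt_of_lt_of_le (Nat.cast_lt.2 ?_) (hΛ.le_order_hamOp A (ih s))
          omega
        rwa [h2, sub_self] at h1
      have hconst := is_const_of_deriv_eq_zero (fun s => (hd s).differentiableAt)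
        (fun s => (hd s).deriv) t 0
      rw [map_sub, HahnSeries.coeff_sub, HahnSeries.coeff_zero]
      refine hconst.trans ?_
      rw [h0, sub_self]
  rw [← sub_eq_zero, ← MvPowerSeries.order_eq_top_iff]
  exact ENat.eq_top_iff_forall_ge.2 fun d => key d t

/-! ### Homogeneous components as sections -/

lemma isHomogeneous_component (F : Series n) (k : ℕ) (j : ℤ) :
    (component F k j).IsHomogeneous k := by
  refine MvPolynomial.IsHomogeneous.sum _ _ _ fun m hm => ?_
  refine MvPolynomial.isHomogeneous_monomial _ ?_
  rw [Finset.mem_finsuppAntidiag] at hm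
  rw [Finsupp.degree_eq_sum]
  exact hm.1

lemma eval_smul_of_isHomogeneous {k : ℕ} {p : Poly n} (hp : p.IsHomogeneous k) (c : ℂ)
    (z : Fin (n + 1) → ℂ) :
    MvPolynomial.eval (c • z) p = c ^ k * MvPolynomial.eval z p := by
  rw [MvPolynomial.eval_eq', MvPolynomial.eval_eq', Finset.mul_sum]
  refine Finset.sum_congr rfl fun m hm => ?_
  have hk : ∑ i, m i = k := by
    rw [← Finsupp.degree_eq_sum]
    by_contra hne
    exact MvPolynomial.mem_support_iff.1 hm (hp.coeff_eq_zero hne)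
  simp only [Pi.smul_apply, smul_eq_mul, mul_pow, Finset.prod_mul_distrib,
    Finset.prod_pow_eq_pow_sum, hk]
  ring

/-- A homogeneous polynomial of degree `k` as a section of `𝒪(k)`. -/
def sectionOfPoly (n k : ℕ) (p : Poly n) (hp : p.IsHomogeneous k) : H0 n k :=
  ⟨fun z => MvPolynomial.eval (z : Fin (n + 1) → ℂ) p,
    ⟨fun z => MvPolynomial.eval z p,
      (AnalyticOnNhd.eval_mvPolynomial p).differentiableOn.mono (Set.subset_univ _), fun _ => rfl⟩,
    fun c z w _ hw => by
      change MvPolynomial.eval (w : Fin (n + 1) → ℂ) p =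
        c ^ (k : ℤ) * MvPolynomial.eval (z : Fin (n + 1) → ℂ) p
      rw [hw, zpow_natCast, eval_smul_of_isHomogeneous hp]⟩

lemma isSumOfSections (F : Series n) : IsSumOfSections F := by
  refine ⟨fun k => ⟨fun j => sectionOfPoly n k (component F k j) (isHomogeneous_component F k j),
    ?_⟩, fun k j z => rfl⟩
  refine Set.IsPWO.mono (t := ⋃ m ∈ (Finset.univ : Finset (Fin (n + 1))).finsuppAntidiag k,
    (coeff m F).support) ?_ fun j hj => ?_
  · exact (Finset.isPWO_bUnion _).2 fun m _ => (coeff m F).isPWO_support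
  · by_contra hne
    simp only [Set.mem_iUnion, not_exists, HahnSeries.mem_support, not_not] at hne
    refine hj (Subtype.ext (funext fun z => ?_))
    change MvPolynomial.eval (z : Fin (n + 1) → ℂ) (component F k j) = 0
    rw [component, Finset.sum_eq_zero fun m hm => by rw [hne m hm, MvPolynomial.monomial_zero],
      map_zero]

/-! ### Jacobi's formula -/

lemma derivation_prod {k R ι : Type*} [CommRing k] [CommRing R] [Algebra k R] [DecidableEq ι]
    (δ : Derivation k R R) (s : Finset ι) (f : ι → R) :
    δ (∏ i ∈ s, f i) = ∑ i ∈ s, δ (f i) * ∏ j ∈ s.erase i, f j := by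
  induction s using Finset.induction_on with
  | empty => simp
  | insert a s ha ih =>
    rw [Finset.prod_insert ha, Derivation.leibniz, ih, Finset.sum_insert ha,
      Finset.erase_insert ha, smul_eq_mul, smul_eq_mul, mul_comm (∏ i ∈ s, f i), add_comm,
      Finset.mul_sum]
    congr 1
    refine Finset.sum_congr rfl fun i hi => ?_
    have hne : a ≠ i := fun h => ha (h ▸ hi)
    rw [Finset.erase_insert_of_ne hne, Finset.prod_insert fun h => ha (Finset.mem_of_mem_erase h)]
    ring

/-- Jacobi's formula for the derivative of a determinant. -/
lemma derivation_det {k R ι : Type*} [CommRing k] [CommRing R] [Algebra k R] [Fintype ι]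
    [DecidableEq ι] (δ : Derivation k R R) (M : Matrix ι ι R) :
    δ M.det = (M.adjugate * M.map δ).trace := by
  have h : ∀ i, (M.adjugate * M.map δ) i i = (M.updateCol i fun j => δ (M j i)).det := by
    intro i
    rw [← Matrix.cramer_apply, Matrix.cramer_eq_adjugate_mulVec]
    rfl
  simp only [Matrix.trace, Matrix.diag_apply, h]
  simp only [Matrix.det_apply, map_sum, Derivation.map_smul_of_tower, derivation_prod,
    Finset.smul_sum]
  rw [Finset.sum_comm]
  refine Finset.sum_congr rfl fun i _ => Finset.sum_congr rfl fun σ _ => ?_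
  congr 1
  rw [← Finset.mul_prod_erase _ _ (Finset.mem_univ i), Matrix.updateCol_self]
  congr 1
  refine Finset.prod_congr rfl fun j hj => ?_
  rw [Matrix.updateCol_ne (Finset.ne_of_mem_erase hj)]

/-! ### Power series identities -/

/-- The Taylor series of `cosh`. -/
def coshSeries : PowerSeries ℂ :=
  (2⁻¹ : ℂ) • (PowerSeries.exp ℂ + PowerSeries.rescale (-1) (PowerSeries.exp ℂ))

/-- The Taylor series of `sinh`. -/
def sinhSeries : PowerSeries ℂ :=
  (2⁻¹ : ℂ) • (PowerSeries.exp ℂ - PowerSeries.rescale (-1) (PowerSeries.exp ℂ))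

lemma coeff_coshSeries (k : ℕ) :
    PowerSeries.coeff k coshSeries = if Even k then (k.factorial : ℂ)⁻¹ else 0 := by
  rw [coshSeries, PowerSeries.coeff_smul, map_add, PowerSeries.coeff_rescale,
    PowerSeries.coeff_exp]
  split_ifs with h
  · rw [h.neg_one_pow]
    simp
    ring
  · rw [(Nat.not_even_iff_odd.1 h).neg_one_pow]
    simp

lemma coeff_sinhSeries (k : ℕ) :
    PowerSeries.coeff k sinhSeries = if Even k then 0 else (k.factorial : ℂ)⁻¹ := by
  rw [sinhSeries, PowerSeries.coeff_smul, map_sub, PowerSeries.coeff_rescale,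
    PowerSeries.coeff_exp]
  split_ifs with h
  · rw [h.neg_one_pow]
    simp
  · rw [(Nat.not_even_iff_odd.1 h).neg_one_pow]
    simp
    ring

lemma rescale_I_cos : PowerSeries.rescale Complex.I (PowerSeries.cos ℂ) = coshSeries := by
  ext k
  rw [coeff_coshSeries, PowerSeries.coeff_rescale, PowerSeries.cos, PowerSeries.coeff_mk]
  split_ifs with h
  · obtain ⟨l, rfl⟩ := h
    rw [← two_mul, pow_mul, Complex.I_sq, Nat.mul_div_cancel_left _ two_pos]
    simp [mul_div_assoc', ← mul_pow]
  · rw [mul_zero]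

lemma rescale_I_sin :
    PowerSeries.rescale Complex.I (PowerSeries.sin ℂ) = Complex.I • sinhSeries := by
  ext k
  rw [PowerSeries.coeff_smul, coeff_sinhSeries, PowerSeries.coeff_rescale, PowerSeries.sin,
    PowerSeries.coeff_mk]
  split_ifs with h
  · simp
  · obtain ⟨l, rfl⟩ := Nat.not_even_iff_odd.1 h
    rw [pow_succ, pow_mul, Complex.I_sq, show (2 * l + 1) / 2 = l by omega]
    have h1 : ((-1 : ℂ) ^ l) * (-1) ^ l = 1 := by rw [← mul_pow]; simp
    rw [map_div₀, map_pow, map_neg, map_one, map_natCast, smul_eq_mul, div_eq_mul_inv]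
    linear_combination (Complex.I * ((2 * l + 1).factorial : ℂ)⁻¹) * h1

lemma tanSeries_mul_coshSeries : tanSeries * coshSeries = sinhSeries := by
  have h0 : PowerSeries.constantCoeff (PowerSeries.cos ℂ) ≠ 0 := by
    rw [← PowerSeries.coeff_zero_eq_constantCoeff_apply, PowerSeries.cos, PowerSeries.coeff_mk]
    simp
  rw [tanSeries, ← rescale_I_cos, smul_mul_assoc, ← map_mul, mul_assoc,
    PowerSeries.inv_mul_cancel _ h0, mul_one, rescale_I_sin, smul_smul,
    inv_mul_cancel₀ Complex.I_ne_zero, one_smul]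

lemma coshSeries_ne_zero : coshSeries ≠ 0 := by
  intro h
  have h1 := coeff_coshSeries 0
  rw [h] at h1
  simp at h1

lemma derivative_coshSeries : PowerSeries.derivative ℂ coshSeries = sinhSeries := by
  ext k
  rw [PowerSeries.coeff_derivative, coeff_coshSeries, coeff_sinhSeries, Nat.factorial_succ]
  have h1 := Nat.cast_ne_zero (R := ℂ).2 (Nat.factorial_ne_zero k)
  have h2 : (k : ℂ) + 1 ≠ 0 := by exact_mod_cast Nat.succ_ne_zero k
  by_cases h : Even k
  · simp [h, Nat.even_add_one]
  · simp [h, Nat.even_add_one]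
    field_simp

lemma derivative_sinhSeries : PowerSeries.derivative ℂ sinhSeries = coshSeries := by
  ext k
  rw [PowerSeries.coeff_derivative, coeff_coshSeries, coeff_sinhSeries, Nat.factorial_succ]
  have h1 := Nat.cast_ne_zero (R := ℂ).2 (Nat.factorial_ne_zero k)
  have h2 : (k : ℂ) + 1 ≠ 0 := by exact_mod_cast Nat.succ_ne_zero k
  by_cases h : Even k
  · simp [h, Nat.even_add_one]
    field_simp
  · simp [h, Nat.even_add_one]

/-- The differential equation of the hyperbolic tangent. -/
lemma derivative_tanSeries : PowerSeries.derivative ℂ tanSeries = 1 - tanSeries * tanSeries := by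
  refine mul_right_cancel₀ coshSeries_ne_zero ?_
  have h := congrArg (PowerSeries.derivative ℂ) tanSeries_mul_coshSeries
  rw [Derivation.leibniz, derivative_coshSeries, derivative_sinhSeries, smul_eq_mul,
    smul_eq_mul] at h
  linear_combination h + tanSeries * tanSeries_mul_coshSeries

lemma coeff_tanSeries_of_even {k : ℕ} (hk : Even k) : PowerSeries.coeff k tanSeries = 0 := by
  have hc : PowerSeries.rescale (-1) coshSeries = coshSeries := by
    ext k
    rw [PowerSeries.coeff_rescale, coeff_coshSeries]
    split_ifs with h
    · rw [h.neg_one_pow, one_mul]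
    · rw [mul_zero]
  have hs : PowerSeries.rescale (-1) sinhSeries = -sinhSeries := by
    ext k
    rw [PowerSeries.coeff_rescale, map_neg, coeff_sinhSeries]
    split_ifs with h
    · simp
    · rw [(Nat.not_even_iff_odd.1 h).neg_one_pow, neg_one_mul]
  have h : PowerSeries.rescale (-1) tanSeries = -tanSeries := by
    refine mul_right_cancel₀ coshSeries_ne_zero ?_
    have h1 := congrArg (PowerSeries.rescale (-1 : ℂ)) tanSeries_mul_coshSeries
    rw [map_mul, hc, hs] at h1
    rw [h1, neg_mul, tanSeries_mul_coshSeries]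
  have h2 := congrArg (PowerSeries.coeff k) h
  rw [PowerSeries.coeff_rescale, hk.neg_one_pow, one_mul, map_neg] at h2
  exact self_eq_neg.1 h2

/-- The Taylor series of `tanh x / x`. -/
def tanShift : PowerSeries ℂ := PowerSeries.mk fun k => PowerSeries.coeff (k + 1) tanSeries

lemma X_mul_tanShift : PowerSeries.X * tanShift = tanSeries := by
  have h := PowerSeries.eq_X_mul_shift_add_const tanSeries
  rw [← PowerSeries.coeff_zero_eq_constantCoeff_apply, coeff_tanSeries_of_even Even.zero, map_zero,
    add_zero] at h
  exact h.symm

/-- A series with constant term `1` has an inverse square root with constant term `1`, namely the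
binomial series of exponent `-1/2`. -/
lemma exists_sq_mul_eq_one {d : Series n} (hd : MvPowerSeries.constantCoeff d = 1) :
    ∃ g : Series n, MvPowerSeries.constantCoeff g = 1 ∧ g ^ 2 * d = 1 := by
  have hx : MvPowerSeries.constantCoeff (d - 1) = 0 := by rw [map_sub, hd, map_one, sub_self]
  have hs := PowerSeries.HasSubst.of_constantCoeff_zero (S := Scalars) hx
  set b : PowerSeries ℂ := PowerSeries.binomialSeries ℂ (-2⁻¹ : ℂ)
  have hb : b ^ 2 * (1 + PowerSeries.X) = 1 := by
    have h1 := PowerSeries.binomialSeries_nat (R := ℂ) (A := ℂ) 1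
    rw [pow_one] at h1
    rw [sq, ← h1, ← PowerSeries.binomialSeries_add, ← PowerSeries.binomialSeries_add]
    norm_num
  set u : Series n := (PowerSeries.map (HahnSeries.C : ℂ →+* Scalars) b).subst (d - 1)
  have hu : u ^ 2 * d = 1 := by
    have h1 := congrArg (fun p => PowerSeries.substAlgHom (R := Scalars) hs
      (PowerSeries.map (HahnSeries.C : ℂ →+* Scalars) p)) hb
    simp only [map_mul, map_pow, map_add, map_one, PowerSeries.map_X,
      PowerSeries.substAlgHom_X] at h1
    rw [add_sub_cancel] at h1
    rwa [PowerSeries.coe_substAlgHom] at h1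
  -- The equation fixes the constant term up to a sign, which a change of sign of `u` corrects.
  have hc : (MvPowerSeries.constantCoeff u) ^ 2 = 1 := by
    have h1 := congrArg MvPowerSeries.constantCoeff hu
    rwa [map_mul, map_pow, hd, mul_one, map_one] at h1
  rcases mul_self_eq_one_iff.1 ((sq _).symm.trans hc) with h | h
  · exact ⟨u, h, hu⟩
  · exact ⟨-u, by rw [map_neg, h, neg_neg], by rwa [neg_sq]⟩

/-! ### The closed form -/

/-- The vector of the coordinates. -/
def coordVec (n : ℕ) : Fin (n + 1) → Series n := MvPowerSeries.X

/-- The matrix `tanh (ΛA)`. -/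
def tanhMat (Λ : Matrix (Fin (n + 1)) (Fin (n + 1)) (Poly n))
    (A : Matrix (Fin (n + 1)) (Fin (n + 1)) ℂ) :
    Matrix (Fin (n + 1)) (Fin (n + 1)) (Series n) :=
  matEval tanSeries (lambdaA Λ A)

lemma IsQuantizable.one_le_order_lambdaA (hΛ : IsQuantizable Λ)
    (A : Matrix (Fin (n + 1)) (Fin (n + 1)) ℂ) (i j : Fin (n + 1)) :
    1 ≤ (lambdaA Λ A i j).order := by
  rw [lambdaA, Matrix.mul_apply]
  refine le_order_sum _ _ fun l _ => le_trans ?_ MvPowerSeries.le_order_mul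
  refine le_trans ?_ (le_add_right (le_order_toSeries _ (hΛ.orderZero i l)))
  exact_mod_cast one_le_two

lemma map_coordField_constMat (α : Fin (n + 1)) : (constMat A).map (coordField Λ α) = 0 := by
  refine Matrix.ext fun i j => ?_
  rw [Matrix.map_apply, constMat_apply, coordField_scalar, Matrix.zero_apply]

lemma map_euler_constMat : (constMat A).map (euler n) = 0 := by
  refine Matrix.ext fun i j => ?_
  rw [Matrix.map_apply, constMat_apply, euler_scalar, Matrix.zero_apply]

lemma IsQuantizable.map_coordField_lambdaA (hΛ : IsQuantizable Λ) (α : Fin (n + 1)) :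
    (lambdaA Λ A).map (coordField Λ α) = scalar n 0 • lambdaA Λ A := by
  rw [lambdaA, map_derivation_mul, map_coordField_constMat, mul_zero, add_zero, map_zero,
    zero_smul]
  have h : (Λ.map toSeries).map (coordField Λ α) = 0 :=
    Matrix.ext fun i j => hΛ.coordField_coeff α i j
  rw [h, zero_mul]

lemma IsQuantizable.map_euler_lambdaA (hΛ : IsQuantizable Λ) :
    (lambdaA Λ A).map (euler n) = scalar n 2 • lambdaA Λ A := by
  rw [lambdaA, map_derivation_mul, map_euler_constMat, mul_zero, add_zero]
  have h : (Λ.map toSeries).map (euler n) = scalar n 2 • Λ.map toSeries :=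
    Matrix.ext fun i j => by
      rw [Matrix.map_apply, Matrix.map_apply, euler_toSeries (hΛ.orderZero i j),
        ← map_natCast (scalar n)]
      rfl
  rw [h, Matrix.smul_mul]

lemma IsQuantizable.map_coordField_matEval (hΛ : IsQuantizable Λ) (α : Fin (n + 1))
    (p : PowerSeries ℂ) : (matEval p (lambdaA Λ A)).map (coordField Λ α) = 0 := by
  rw [map_derivation_matEval (continuous_coordField Λ α) (hΛ.one_le_order_lambdaA A)
    (hΛ.map_coordField_lambdaA α), matEval_smul _ _ (hΛ.one_le_order_lambdaA A), map_zero,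
    zero_smul]

lemma IsQuantizable.map_euler_matEval (hΛ : IsQuantizable Λ) (p : PowerSeries ℂ) :
    (matEval p (lambdaA Λ A)).map (euler n) =
      scalar n 2 • matEval (PowerSeries.X * PowerSeries.derivative ℂ p) (lambdaA Λ A) := by
  rw [map_derivation_matEval continuous_euler (hΛ.one_le_order_lambdaA A)
    hΛ.map_euler_lambdaA, matEval_smul _ _ (hΛ.one_le_order_lambdaA A)]

lemma IsQuantizable.coshMat_eq (hΛ : IsQuantizable Λ) :
    coshMat Λ A = matEval coshSeries (lambdaA Λ A) := by
  have hM := hΛ.one_le_order_lambdaA A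
  rw [coshMat, matEval_neg_arg, ← matEval_add _ _ hM, coshSeries, matEval_smul _ _ hM]
  refine Matrix.ext fun i j => ?_
  have h : (HahnSeries.C (2⁻¹ : ℂ) : Scalars) = (2 : Scalars)⁻¹ := by
    rw [map_inv₀, map_ofNat]
  rw [Matrix.smul_apply, Matrix.smul_apply, smul_eq_mul, ← C_smul, h]

lemma phaseMat_eq : phaseMat Λ A = constMat A * matEval tanShift (lambdaA Λ A) := rfl

lemma IsQuantizable.mul_phaseMat (hΛ : IsQuantizable Λ) :
    Λ.map toSeries * phaseMat Λ A = tanhMat Λ A := by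
  have hM := hΛ.one_le_order_lambdaA A
  rw [phaseMat_eq, ← mul_assoc, tanhMat, ← X_mul_tanShift, matEval_mul _ _ hM, matEval_X hM]
  rfl

lemma IsQuantizable.transpose_map_toSeries (hΛ : IsQuantizable Λ) :
    (Λ.map toSeries)ᵀ = -Λ.map toSeries := by
  refine Matrix.ext fun i j => ?_
  rw [Matrix.transpose_apply, Matrix.map_apply, Matrix.neg_apply, Matrix.map_apply,
    hΛ.apply_swap j i, toSeries_neg]

lemma transpose_constMat (hA : A.IsSymm) : (constMat A)ᵀ = (constMat A : Matrix _ _ (Series n)) :=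
  Matrix.ext fun i j => by rw [Matrix.transpose_apply, constMat_apply, constMat_apply, hA.apply]

/-- `A (ΛA)ᵏ` is symmetric for even `k` and antisymmetric for odd `k`. -/
lemma IsQuantizable.transpose_constMat_mul_pow (hΛ : IsQuantizable Λ) (hA : A.IsSymm) (k : ℕ) :
    (constMat A * lambdaA Λ A ^ k)ᵀ = (-1 : Series n) ^ k • (constMat A * lambdaA Λ A ^ k) := by
  have hsemi : SemiconjBy (constMat A) (lambdaA Λ A) (constMat A * Λ.map toSeries) := by
    rw [SemiconjBy, lambdaA, mul_assoc]
  have hT : (lambdaA Λ A)ᵀ = -(constMat A * Λ.map toSeries) := by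
    rw [lambdaA, Matrix.transpose_mul, hΛ.transpose_map_toSeries, transpose_constMat hA, mul_neg]
  rw [Matrix.transpose_mul, Matrix.transpose_pow, hT, transpose_constMat hA,
    (hsemi.pow_right k).eq, neg_pow, mul_assoc]
  rcases Nat.even_or_odd k with h | h
  · rw [h.neg_one_pow, h.neg_one_pow, one_mul, one_smul]
  · rw [h.neg_one_pow, h.neg_one_pow, neg_one_mul, neg_one_smul]

/-- The phase is symmetric because the hyperbolic tangent is odd. -/
lemma IsQuantizable.transpose_phaseMat (hΛ : IsQuantizable Λ) (hA : A.IsSymm) :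
    (phaseMat Λ A)ᵀ = phaseMat Λ A := by
  have h1 : HasSum (fun k => constMat A * matTerm tanShift (lambdaA Λ A) k) (phaseMat Λ A) :=
    (hasSum_matEval tanShift (hΛ.one_le_order_lambdaA A)).mul_left (constMat A)
  refine h1.matrix_transpose.unique ?_
  refine Eq.mpr (congrArg (HasSum · _) (funext fun k => ?_)) h1
  rw [matTerm, Matrix.mul_smul, Matrix.transpose_smul, hΛ.transpose_constMat_mul_pow hA]
  rcases Nat.even_or_odd k with h | h
  · rw [h.neg_one_pow, one_smul]
  · rw [tanShift, PowerSeries.coeff_mk, coeff_tanSeries_of_even h.add_one, map_zero, zero_smul,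
      zero_smul]

lemma IsQuantizable.constMat_mul_tanhMat (hΛ : IsQuantizable Λ) :
    constMat A * tanhMat Λ A = phaseMat Λ A * lambdaA Λ A := by
  have hM := hΛ.one_le_order_lambdaA A
  rw [phaseMat_eq, mul_assoc, ← commute_matEval _ hM, tanhMat, ← X_mul_tanShift,
    matEval_mul _ _ hM, matEval_X hM]

lemma IsQuantizable.transpose_tanhMat_mul (hΛ : IsQuantizable Λ) (hA : A.IsSymm) :
    (tanhMat Λ A)ᵀ * constMat A = -(constMat A * tanhMat Λ A) := by
  rw [hΛ.constMat_mul_tanhMat, ← hΛ.mul_phaseMat, Matrix.transpose_mul,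
    hΛ.transpose_map_toSeries, hΛ.transpose_phaseMat hA, mul_neg, neg_mul, mul_assoc]
  rfl

/-- The Riccati equation of the phase. -/
lemma IsQuantizable.euler_phaseMat (hΛ : IsQuantizable Λ) :
    (2 : Series n) • phaseMat Λ A + (phaseMat Λ A).map (euler n) =
      (2 : Series n) • (constMat A - constMat A * (tanhMat Λ A * tanhMat Λ A)) := by
  have hM := hΛ.one_le_order_lambdaA A
  have h2 : scalar n 2 = 2 := map_ofNat _ 2
  have hd : tanShift + PowerSeries.X * PowerSeries.derivative ℂ tanShift +
      tanSeries * tanSeries = 1 := by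
    have h := derivative_tanSeries
    rw [← X_mul_tanShift, Derivation.leibniz, PowerSeries.derivative_X, smul_eq_mul,
      smul_eq_mul] at h
    rw [← X_mul_tanShift]
    linear_combination h
  have hd' := congrArg (matEval · (lambdaA Λ A)) hd
  simp only [matEval_add _ _ hM, matEval_one hM] at hd'
  rw [matEval_mul tanSeries tanSeries hM] at hd'
  rw [phaseMat_eq, map_derivation_mul, map_euler_constMat, zero_mul, zero_add,
    hΛ.map_euler_matEval, h2, Matrix.mul_smul, ← smul_add, ← mul_add]
  congr 1
  conv_rhs => rw [← mul_one (constMat A), mul_assoc, ← mul_sub, one_mul]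
  rw [tanhMat, ← hd', add_sub_cancel_right]

lemma derivation_dotProduct (δ : Derivation Scalars (Series n) (Series n))
    (u v : Fin (n + 1) → Series n) : δ (u ⬝ᵥ v) = (δ ∘ u) ⬝ᵥ v + u ⬝ᵥ (δ ∘ v) := by
  simp only [dotProduct, map_sum, Derivation.leibniz, smul_eq_mul, Function.comp,
    ← Finset.sum_add_distrib]
  exact Finset.sum_congr rfl fun i _ => by ring

lemma derivation_mulVec (δ : Derivation Scalars (Series n) (Series n))
    (M : Matrix (Fin (n + 1)) (Fin (n + 1)) (Series n)) (v : Fin (n + 1) → Series n) :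
    δ ∘ (M.mulVec v) = (M.map δ).mulVec v + M.mulVec (δ ∘ v) :=
  funext fun i => derivation_dotProduct δ (M i) v

lemma two_ne_zero_series : (2 : Series n) ≠ 0 := by
  rw [← map_ofNat (scalar n) 2]
  exact (map_ne_zero_iff _ (scalar n).injective).2 two_ne_zero

lemma dotProduct_mulVec_eq_zero {N : Matrix (Fin (n + 1)) (Fin (n + 1)) (Series n)}
    (hN : Nᵀ = -N) (v : Fin (n + 1) → Series n) : v ⬝ᵥ N.mulVec v = 0 := by
  have h : v ⬝ᵥ N.mulVec v = -(v ⬝ᵥ N.mulVec v) := by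
    conv_lhs => rw [Matrix.dotProduct_mulVec, ← Matrix.mulVec_transpose, hN, Matrix.neg_mulVec,
      neg_dotProduct, dotProduct_comm]
  have h2 : (2 : Series n) * (v ⬝ᵥ N.mulVec v) = 0 := by linear_combination h
  exact (mul_eq_zero.1 h2).resolve_left two_ne_zero_series

lemma quadForm_eq (Q : Matrix (Fin (n + 1)) (Fin (n + 1)) (Series n)) :
    quadForm Q = coordVec n ⬝ᵥ Q.mulVec (coordVec n) := by
  refine Finset.sum_congr rfl fun i _ => ?_
  rw [Matrix.mulVec, dotProduct, Finset.mul_sum]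
  exact Finset.sum_congr rfl fun j _ => mul_assoc _ _ _

lemma coordField_comp_coordVec (α : Fin (n + 1)) :
    coordField Λ α ∘ coordVec n = Λ.map toSeries α :=
  funext fun β => coordField_X Λ α β

lemma euler_comp_coordVec : euler n ∘ coordVec n = coordVec n :=
  funext fun β => euler_X β

lemma IsQuantizable.coordField_quadForm (hΛ : IsQuantizable Λ) (hA : A.IsSymm) (α : Fin (n + 1)) :
    coordField Λ α (quadForm (phaseMat Λ A)) = 2 * (tanhMat Λ A).mulVec (coordVec n) α := by
  have h0 : (phaseMat Λ A).map (coordField Λ α) = 0 := by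
    rw [phaseMat_eq, map_derivation_mul, map_coordField_constMat, hΛ.map_coordField_matEval,
      zero_mul, mul_zero, add_zero]
  have h1 : Λ.map toSeries α ⬝ᵥ (phaseMat Λ A).mulVec (coordVec n) =
      (tanhMat Λ A).mulVec (coordVec n) α := by
    rw [← hΛ.mul_phaseMat, ← Matrix.mulVec_mulVec]
    rfl
  rw [quadForm_eq, derivation_dotProduct, derivation_mulVec, h0, Matrix.zero_mulVec, zero_add,
    coordField_comp_coordVec, h1, Matrix.dotProduct_mulVec, ← Matrix.mulVec_transpose,
    hΛ.transpose_phaseMat hA, dotProduct_comm, h1, two_mul]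

lemma IsQuantizable.coordField_tanhMat_mulVec (hΛ : IsQuantizable Λ) (α β : Fin (n + 1)) :
    coordField Λ α ((tanhMat Λ A).mulVec (coordVec n) β) =
      -(tanhMat Λ A * Λ.map toSeries) β α := by
  have h := congrFun (derivation_mulVec (coordField Λ α) (tanhMat Λ A) (coordVec n)) β
  rw [tanhMat, hΛ.map_coordField_matEval, Matrix.zero_mulVec, zero_add,
    coordField_comp_coordVec] at h
  rw [← Matrix.neg_apply, ← mul_neg, ← hΛ.transpose_map_toSeries]
  exact h

lemma IsQuantizable.euler_quadForm (hΛ : IsQuantizable Λ) :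
    euler n (quadForm (phaseMat Λ A)) =
      2 * quadForm (constMat A - constMat A * (tanhMat Λ A * tanhMat Λ A)) := by
  have h := congrArg quadForm (hΛ.euler_phaseMat (A := A))
  simp only [quadForm_eq, Matrix.add_mulVec, Matrix.smul_mulVec, dotProduct_add,
    dotProduct_smul, smul_eq_mul] at h
  rw [quadForm_eq, quadForm_eq, ← h, derivation_dotProduct, derivation_mulVec,
    euler_comp_coordVec, dotProduct_add]
  ring

lemma constantCoeff_quadForm (Q : Matrix (Fin (n + 1)) (Fin (n + 1)) (Series n)) :
    MvPowerSeries.constantCoeff (quadForm Q) = 0 := by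
  rw [quadForm, map_sum]
  refine Finset.sum_eq_zero fun i _ => ?_
  rw [map_sum]
  refine Finset.sum_eq_zero fun j _ => ?_
  rw [map_mul, MvPowerSeries.constantCoeff_X, mul_zero]

lemma IsQuantizable.constantCoeff_det_coshMat (hΛ : IsQuantizable Λ) :
    MvPowerSeries.constantCoeff (coshMat Λ A).det = 1 := by
  have hM := hΛ.one_le_order_lambdaA A
  have h0 : MvPowerSeries.constantCoeff.mapMatrix (lambdaA Λ A) = 0 :=
    Matrix.ext fun i j => MvPowerSeries.one_le_order_iff_constCoeff_eq_zero.1 (hM i j)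
  have h := PowerSeries.eq_X_mul_shift_add_const coshSeries
  rw [← PowerSeries.coeff_zero_eq_constantCoeff_apply, coeff_coshSeries, if_pos Even.zero,
    Nat.factorial_zero, Nat.cast_one, inv_one, map_one] at h
  rw [hΛ.coshMat_eq, h, matEval_add _ _ hM, matEval_mul _ _ hM, matEval_X hM, matEval_one hM,
    RingHom.map_det, map_add, map_mul, h0, zero_mul, map_one, zero_add, Matrix.det_one]

lemma IsQuantizable.coordField_det_coshMat (hΛ : IsQuantizable Λ) (α : Fin (n + 1)) :
    coordField Λ α (coshMat Λ A).det = 0 := by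
  rw [derivation_det, hΛ.coshMat_eq, hΛ.map_coordField_matEval, mul_zero, Matrix.trace_zero]

lemma IsQuantizable.euler_det_coshMat (hΛ : IsQuantizable Λ) :
    euler n (coshMat Λ A).det =
      2 * (lambdaA Λ A * tanhMat Λ A).trace * (coshMat Λ A).det := by
  have hM := hΛ.one_le_order_lambdaA A
  have h2 : scalar n 2 = 2 := map_ofNat _ 2
  have h : (coshMat Λ A).map (euler n) =
      (2 : Series n) • (lambdaA Λ A * tanhMat Λ A * coshMat Λ A) := by
    rw [hΛ.coshMat_eq, hΛ.map_euler_matEval, derivative_coshSeries, ← tanSeries_mul_coshSeries,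
      matEval_mul _ _ hM, matEval_mul _ _ hM, matEval_X hM, h2, mul_assoc, tanhMat]
  rw [derivation_det, h, Matrix.mul_smul, Matrix.trace_smul, Matrix.trace_mul_comm, mul_assoc,
    Matrix.mul_adjugate, Matrix.mul_smul, mul_one, Matrix.trace_smul, smul_eq_mul, smul_eq_mul]
  ring

/-- The closed form satisfies the Euler equation of the star exponential. -/
lemma IsQuantizable.euler_closedForm (hΛ : IsQuantizable Λ) (hA : A.IsSymm) {g : Series n}
    (hg : g ^ 2 * (coshMat Λ A).det = 1) :
    euler n (g * expSeries (mu⁻¹ • quadForm (phaseMat Λ A))) =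
      2 * hamOp Λ A (g * expSeries (mu⁻¹ • quadForm (phaseMat Λ A))) := by
  set B := (constMat A : Matrix (Fin (n + 1)) (Fin (n + 1)) (Series n)) with hB
  set T := tanhMat Λ A
  set x := mu⁻¹ • quadForm (phaseMat Λ A) with hx
  set c : Series n := MvPowerSeries.C mu⁻¹ with hc
  set w := T.mulVec (coordVec n) with hw
  have hx' : x = c * quadForm (phaseMat Λ A) := MvPowerSeries.smul_eq_C_mul _ _
  have hx0 : MvPowerSeries.constantCoeff x = 0 := by
    rw [hx', map_mul, constantCoeff_quadForm, mul_zero]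
  -- A derivation acts on `g` through the logarithmic derivative of the determinant.
  have hlog : ∀ (δ : Derivation Scalars (Series n) (Series n)) (s : Series n),
      δ (coshMat Λ A).det = 2 * s * (coshMat Λ A).det → δ g = -s * g := by
    intro δ s hs
    have h := congrArg δ hg
    rw [Derivation.leibniz, sq, Derivation.leibniz, hs, Derivation.map_one_eq_zero, smul_eq_mul,
      smul_eq_mul, smul_eq_mul] at h
    have h2 : (2 : Series n) * (δ g + s * g) = 0 := by
      linear_combination g * h - 2 * (δ g + s * g) * hg
    linear_combination (mul_eq_zero.1 h2).resolve_left two_ne_zero_series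
  have hDg : ∀ α, coordField Λ α g = 0 := fun α => by
    rw [hlog (coordField Λ α) 0 (by rw [hΛ.coordField_det_coshMat]; ring), neg_zero, zero_mul]
  have hEg := hlog (euler n) _ hΛ.euler_det_coshMat
  set G := g * expSeries x with hG
  have hDc : ∀ α f, coordField Λ α (c * f) = c * coordField Λ α f :=
    fun α f => derivation_C_mul _ _ _
  have hDG : ∀ α, coordField Λ α G = 2 * c * w α * G := fun α => by
    rw [hG, Derivation.leibniz, derivation_expSeries (continuous_coordField Λ α) hx0, hDg, hx',
      hDc, hΛ.coordField_quadForm hA, smul_zero, add_zero, smul_eq_mul]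
    ring
  have hDDG : ∀ α β, coordField Λ α (coordField Λ β G) =
      (-(2 * c * (T * Λ.map toSeries) β α) + 4 * c ^ 2 * (w α * w β)) * G := fun α β => by
    rw [hDG β, show 2 * c * w β * G = c * (w β * G + w β * G) by ring, hDc, map_add,
      Derivation.leibniz, hDG α, hΛ.coordField_tanhMat_mulVec, smul_eq_mul, smul_eq_mul]
    ring
  have hEG : euler n G = (2 * c * quadForm (B - B * (T * T)) - (lambdaA Λ A * T).trace) * G := by
    rw [hG, Derivation.leibniz, derivation_expSeries continuous_euler hx0, hEg, hx',
      euler_C_mul, hΛ.euler_quadForm, smul_eq_mul, smul_eq_mul]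
    ring
  have hmu : MvPowerSeries.C (mu / 4) * c * 4 = 1 := by
    have h2 := natCast_ne_zero_scalars four_ne_zero
    have h3 := mu_ne_zero
    rw [show (4 : Series n) = MvPowerSeries.C (4 : Scalars) from (map_ofNat _ 4).symm, ← map_mul,
      ← map_mul, ← map_one MvPowerSeries.C]
    congr 1
    push_cast at h2
    field_simp
  have hlin : ∀ α, linForm A α = B.mulVec (coordVec n) α := fun α =>
    Finset.sum_congr rfl fun j _ => congrArg (· * _) (constMat_apply A α j).symm
  have hH : hamiltonian A = c * (coordVec n ⬝ᵥ B.mulVec (coordVec n)) := by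
    rw [hamiltonian_eq]
    simp only [hlin]
    rfl
  -- The first order term vanishes, as `A tanh (ΛA)` is antisymmetric.
  have hfirst : B.mulVec (coordVec n) ⬝ᵥ w = 0 := by
    have h1 : B.mulVec (coordVec n) ⬝ᵥ w = coordVec n ⬝ᵥ (B * T).mulVec (coordVec n) := by
      rw [hw, ← Matrix.mulVec_mulVec, Matrix.dotProduct_mulVec (coordVec n) B,
        ← Matrix.mulVec_transpose, transpose_constMat hA]
    rw [h1]
    refine dotProduct_mulVec_eq_zero ?_ _
    rw [Matrix.transpose_mul, transpose_constMat hA, hΛ.transpose_tanhMat_mul hA]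
  have hsecond : w ⬝ᵥ B.mulVec w = -(coordVec n ⬝ᵥ (B * (T * T)).mulVec (coordVec n)) := by
    have h1 : w ⬝ᵥ B.mulVec w = coordVec n ⬝ᵥ (Tᵀ * (B * T)).mulVec (coordVec n) := by
      rw [hw, ← Matrix.mulVec_mulVec, ← Matrix.mulVec_mulVec, Matrix.dotProduct_mulVec (coordVec n),
        Matrix.vecMul_transpose]
    rw [h1, ← mul_assoc, hΛ.transpose_tanhMat_mul hA, neg_mul, mul_assoc, Matrix.neg_mulVec,
      dotProduct_neg]
  have hsum1 : ∑ α, linForm A α * coordField Λ α G = 0 := by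
    have h1 : ∑ α, linForm A α * coordField Λ α G = 2 * c * G * (B.mulVec (coordVec n) ⬝ᵥ w) := by
      rw [dotProduct, Finset.mul_sum]
      exact Finset.sum_congr rfl fun α _ => by rw [hDG, hlin]; ring
    rw [h1, hfirst, mul_zero]
  have htr : (B * (T * Λ.map toSeries)).trace = (lambdaA Λ A * T).trace := by
    rw [← mul_assoc, Matrix.trace_mul_cycle]
    rfl
  have hsum2 : ∑ α, ∑ β, MvPowerSeries.C (mu / 4) * scalar n (A α β) *
      coordField Λ α (coordField Λ β G) = MvPowerSeries.C (mu / 4) * c * G *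
        (4 * c * (w ⬝ᵥ B.mulVec w) - 2 * (lambdaA Λ A * T).trace) := by
    rw [← htr, dotProduct, Matrix.trace, Finset.mul_sum, Finset.mul_sum,
      ← Finset.sum_sub_distrib, Finset.mul_sum]
    refine Finset.sum_congr rfl fun α _ => ?_
    rw [Matrix.diag_apply, Matrix.mul_apply, Matrix.mulVec, dotProduct, Finset.mul_sum,
      Finset.mul_sum, Finset.mul_sum, ← Finset.sum_sub_distrib, Finset.mul_sum]
    refine Finset.sum_congr rfl fun β _ => ?_
    rw [hDDG, hB, constMat_apply]
    ring
  rw [hamOp, hsum1, hsum2, hEG, hH, hsecond, quadForm_eq, Matrix.sub_mulVec, dotProduct_sub]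
  linear_combination (G * (2 * c * (coordVec n ⬝ᵥ (B * (T * T)).mulVec (coordVec n)) +
    (lambdaA Λ A * T).trace)) * hmu

/-- The star exponential equals the closed form, since both satisfy the Euler equation and have
constant term `1`. -/
lemma IsQuantizable.starExp_eq_closedForm (hΛ : IsQuantizable Λ) (hA : A.IsSymm) {g : Series n}
    (hg1 : MvPowerSeries.constantCoeff g = 1) (hg : g ^ 2 * (coshMat Λ A).det = 1) :
    starExp Λ (hamiltonian A) = g * expSeries (mu⁻¹ • quadForm (phaseMat Λ A)) := by
  set G := g * expSeries (mu⁻¹ • quadForm (phaseMat Λ A)) with hG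
  have hx : MvPowerSeries.constantCoeff (mu⁻¹ • quadForm (phaseMat Λ A)) = 0 := by
    rw [MvPowerSeries.smul_eq_C_mul, map_mul, constantCoeff_quadForm, mul_zero]
  have hsub : hamOp Λ A (starExp Λ (hamiltonian A) - G) =
      hamOp Λ A (starExp Λ (hamiltonian A)) - hamOp Λ A G := by
    rw [eq_sub_iff_add_eq, ← hamOp_add, sub_add_cancel]
  refine sub_eq_zero.1 (hΛ.eq_zero_of_euler_eq A ?_ ?_)
  · rw [map_sub, hΛ.constantCoeff_starExp hA, hG, map_mul, hg1, constantCoeff_expSeries hx,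
      mul_one, sub_self]
  · rw [map_sub, hΛ.euler_starExp hA, hΛ.euler_closedForm hA hg, hsub, mul_sub]

end StarExp

end

theorem theorem1p3 (n : ℕ)
    (Λ : Matrix (Fin (n + 1)) (Fin (n + 1)) (MvPolynomial (Fin (n + 1)) ℂ))
    (hΛ : StarExp.IsQuantizable Λ)
    (A : Matrix (Fin (n + 1)) (Fin (n + 1)) ℂ) (hA : A.IsSymm) :
    -- the star exponential series converges formally
    StarExp.IsFormallySummable (StarExp.starExpTerm Λ (StarExp.hamiltonian A)) ∧
    -- `t ↦ e_⋆^{(t/μ) A[Z]}` is the unique solution of `∂ₜ F = (1/μ) A[Z] ⋆ F`, `F(0) = 1`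
    (∀ F : ℂ → StarExp.Series n,
      (F 0 = 1 ∧ ∀ (t : ℂ) (m : Fin (n + 1) →₀ ℕ) (j : ℤ),
        HasDerivAt (fun t => (MvPowerSeries.coeff m (F t)).coeff j)
          ((MvPowerSeries.coeff m (StarExp.star Λ (StarExp.hamiltonian A) (F t))).coeff j) t) ↔
      ∀ t, F t = StarExp.starExp Λ (StarExp.hamiltonian (t • A))) ∧
    -- the closed form; `g` is `det^{-1/2}((e^{ΛA} + e^{-ΛA})/2)`
    (∃ g : StarExp.Series n,
      MvPowerSeries.constantCoeff g = 1 ∧ g ^ 2 * (StarExp.coshMat Λ A).det = 1 ∧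
      StarExp.starExp Λ (StarExp.hamiltonian A) =
        g * StarExp.expSeries (StarExp.mu⁻¹ • StarExp.quadForm (StarExp.phaseMat Λ A))) ∧
    StarExp.IsSumOfSections (StarExp.starExp Λ (StarExp.hamiltonian A)) := by
  refine ⟨hΛ.summable_starExpTerm hA,
    fun F => ⟨fun hF t => ?_, fun hF => ⟨?_, fun t m j => ?_⟩⟩, ?_, StarExp.isSumOfSections _⟩
  · refine hΛ.eq_of_hasDerivAt (hF.1.trans (hΛ.starExp_zero_smul hA).symm) (fun t m j => ?_)
      (fun t m j => hΛ.hasDerivAt_starExp hA t m j) t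
    rw [← hΛ.star_hamiltonian hA]
    exact hF.2 t m j
  · rw [hF, hΛ.starExp_zero_smul hA]
  · obtain rfl := funext hF
    rw [hΛ.star_hamiltonian hA]
    exact hΛ.hasDerivAt_starExp hA t m j
  · obtain ⟨g, hg1, hg⟩ := StarExp.exists_sq_mul_eq_one hΛ.constantCoeff_det_coshMat
    exact ⟨g, hg1, hg, hΛ.starExp_eq_closedForm hA hg1 hg⟩
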